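/- Let $E^4_1=\mathbb R^4$ carry the Minkowski metric $h(x,y)=x^1y^1+x^2y^2+x^3y^3-x^4y^4$ and its standard orientation, and let $\mathcal B$ be the set of bases $(e_1,e_2,e_3,e_4)$ of $E^4_1$ that give the orientation and are pseudo-orthonormal with $e_1,e_2,e_3$ space-like and $e_4$ time-like ($h(e_i,e_j)=0$ for $i\ne j$, $h(e_i,e_i)=1$ for $i\le 3$, $h(e_4,e_4)=-1$). Let $SO(3,1)$ be the group of real $4\times4$ matrices of determinant $1$ preserving $h$; it acts linearly on $\bigwedge^2E^4_1$ by $P\cdot(x\wedge y)=Px\wedge Py$. Fix $e\in\mathcal B$. For $\Omega=\sum_{i<j}c_{ij}\,e_i\wedge e_j$ put $A(\Omega)=c_{12}^2+c_{13}^2+c_{23}^2$ and $B(\Omega)=c_{14}^2+c_{24}^2+c_{34}^2$. The light cone is $L=\{\Omega \mid A(\Omega)=B(\Omega)\neq0\}$, and for $r>0$ the $r$-slice is $L_r=\{\Omega\in L\mid A(\Omega)=B(\Omega)=r^2\}$. For $u\in\mathcal B$ (for instance $u=e$) and $\phi\in[0,\pi]$ let $$\Omega_\phi=\sqrt2\,\bigl((\cos\phi)\,u_1\wedge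 u_2+(\sin\phi)\,u_2\wedge u_3+u_3\wedge u_4\bigr),$$ let $\mathcal L(\Omega_\phi)$ be its $SO(3,1)$-orbit, $\mathcal L_r(\Omega_\phi)=\mathcal L(\Omega_\phi)\cap L_r$, and $$r(\phi)=\inf\{r>0\mid \mathcal L_r(\Omega_\phi)\neq\emptyset\}.$$ Put $t(\phi)=\tanh^{-1}(\tan(\phi/2))$ for $\phi\in[0,\pi/2)$ and $t(\phi)=\tanh^{-1}(\cot(\phi/2))$ for $\phi\in(\pi/2,\pi]$. **Theorem.** For every $\phi\in[0,\pi]\setminus\{\pi/2\}$, $r(\phi)$ is positive, and $$r(\phi)=\begin{cases}\sqrt2\,\dfrac{\cos(\phi/2)}{\cosh t(\phi)} & (\phi\in[0,\pi/2)),\\[2mm] \sqrt2\,\dfrac{\sin(\phi/2)}{\cosh t(\phi)} & (\phi\in(\pi/2,\pi]).\end{cases}$$ Moreover $r(\pi-\phi)=r(\phi)$ for these $\phi$, $\lim_{\phi\to\pi/2}r(\phi)=0$, and $r$ is strictly decreasing on $[0,\pi/2)$. In addition, for every $\phi\in[0,\pi]\setminus\{\pi/2\}$: (a) for every $r>r(\phi)$,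 $\mathcal L_r(\Omega_\phi)$ is not empty and is a submanifold of $\bigwedge^2E^4_1$ diffeomorphic to $\mathbb RP^3$; (b) $\mathcal L_{r(\phi)}(\Omega_\phi)$ is not empty and is a submanifold of $\bigwedge^2E^4_1$ diffeomorphic to $S^2$. -/

import Mathlib

open Set Filter Topology Module
open scoped Manifold ContDiff

noncomputable section

/-! ### Real projective space as a smooth manifold -/

/-- Real projective `n`-space: the lines through the origin of `ℝ^(n+1)`. -/
def RealProjectiveSpace (n : ℕ) : Type := Projectivization ℝ (Fin (n + 1) → ℝ)

namespace RealProjectiveSpace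

variable {n : ℕ}

/-- The line spanned by a nonzero vector. -/
def mk (v : {v : Fin (n + 1) → ℝ // v ≠ 0}) : RealProjectiveSpace n :=
  Projectivization.mk' ℝ v

/-- The quotient topology. -/
instance : TopologicalSpace (RealProjectiveSpace n) :=
  TopologicalSpace.coinduced (mk (n := n)) inferInstance

theorem isQuotientMap_mk : IsQuotientMap (mk (n := n)) :=
  ⟨⟨rfl⟩, fun p => Quotient.exists_rep p⟩

/-- The domain `{[x] | x i ≠ 0}` of the `i`-th affine chart. -/
def chartDomain (i : Fin (n + 1)) : Set (RealProjectiveSpace n) :=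
  {p | Projectivization.lift (K := ℝ)
    (fun v : {v : Fin (n + 1) → ℝ // v ≠ 0} => v.1 i ≠ 0)
    (fun a b t h => by
      have ha := a.2
      rw [h] at ha
      have ht : t ≠ 0 := fun h0 => ha (by simp [h0])
      simp [h, ht]) p}

theorem mk_mem_chartDomain (i : Fin (n + 1)) (v : {v : Fin (n + 1) → ℝ // v ≠ 0}) :
    mk v ∈ chartDomain i ↔ v.1 i ≠ 0 := Iff.rfl

/-- The affine coordinates `[x] ↦ (x j / x i)_{j ≠ i}`. -/
def affineCoord (i : Fin (n + 1)) : RealProjectiveSpace n → EuclideanSpace ℝ (Fin n) :=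
  Projectivization.lift (K := ℝ)
    (fun v : {v : Fin (n + 1) → ℝ // v ≠ 0} => WithLp.toLp 2 fun j => v.1 (i.succAbove j) / v.1 i)
    (fun a b t h => by
      have ha := a.2
      rw [h] at ha
      have ht : t ≠ 0 := fun h0 => ha (by simp [h0])
      congr 1
      funext j
      simp [h, mul_div_mul_left _ _ ht])

theorem affineCoord_mk (i : Fin (n + 1)) (v : {v : Fin (n + 1) → ℝ // v ≠ 0}) :
    affineCoord i (mk v) = WithLp.toLp 2 fun j => v.1 (i.succAbove j) / v.1 i := rfl

/-- The vector with `i`-th entry `1` and remaining entries `y`. -/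
def affineVec (i : Fin (n + 1)) (y : EuclideanSpace ℝ (Fin n)) :
    {v : Fin (n + 1) → ℝ // v ≠ 0} :=
  ⟨i.insertNth 1 y.ofLp, fun h => by simpa using congrFun h i⟩

theorem continuous_affineVec (i : Fin (n + 1)) : Continuous (affineVec i) := by
  refine Continuous.subtype_mk (continuous_pi fun k => ?_) _
  refine Fin.succAboveCases i ?_ (fun j => ?_) k
  · simpa using continuous_const
  · simp only [Fin.insertNth_apply_succAbove]
    fun_prop

/-- The `i`-th affine chart. -/
def affineChart (i : Fin (n + 1)) :
    OpenPartialHomeomorph (RealProjectiveSpace n) (EuclideanSpace ℝ (Fin n)) where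
  toFun := affineCoord i
  invFun y := mk (affineVec i y)
  source := chartDomain i
  target := univ
  map_source' _ _ := mem_univ _
  map_target' y _ := by simp [mk_mem_chartDomain, affineVec]
  left_inv' p hp := by
    obtain ⟨v, rfl⟩ := isQuotientMap_mk.surjective p
    rw [mk_mem_chartDomain] at hp
    refine (Projectivization.mk_eq_mk_iff' ℝ _ _ (affineVec i _).2 v.2).2 ⟨(v.1 i)⁻¹, ?_⟩
    funext k
    refine Fin.succAboveCases i ?_ (fun j => ?_) k
    · simp [affineVec, hp]
    · simp [affineVec, affineCoord_mk, div_eq_inv_mul]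
  right_inv' y _ := by
    rw [affineCoord_mk]
    ext j
    simp [affineVec]
  open_source := by
    rw [← isQuotientMap_mk.isOpen_preimage]
    exact isOpen_ne_fun ((continuous_apply i).comp continuous_subtype_val) continuous_const
  open_target := isOpen_univ
  continuousOn_toFun := by
    have ho : IsOpen (chartDomain i) := by
      rw [← isQuotientMap_mk.isOpen_preimage]
      exact isOpen_ne_fun ((continuous_apply i).comp continuous_subtype_val) continuous_const
    rw [isQuotientMap_mk.continuousOn_isOpen_iff ho]
    refine (PiLp.continuous_toLp 2 _).comp_continuousOn (continuousOn_pi.2 fun j => ?_)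
    have hc : ∀ l, Continuous fun v : {v : Fin (n + 1) → ℝ // v ≠ 0} => v.1 l :=
      fun l => (continuous_apply l).comp continuous_subtype_val
    exact ContinuousOn.div (hc _).continuousOn (hc _).continuousOn fun v hv => hv
  continuousOn_invFun :=
    (isQuotientMap_mk.continuous.comp (continuous_affineVec i)).continuousOn

theorem exists_mem_chartDomain (p : RealProjectiveSpace n) : ∃ i, p ∈ chartDomain i := by
  obtain ⟨v, rfl⟩ := isQuotientMap_mk.surjective p
  exact Function.ne_iff.1 v.2

/-- The standard atlas, formed by the `n + 1` affine charts. -/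
instance : ChartedSpace (EuclideanSpace ℝ (Fin n)) (RealProjectiveSpace n) where
  atlas := range affineChart
  chartAt p := affineChart (exists_mem_chartDomain p).choose
  mem_chart_source p := (exists_mem_chartDomain p).choose_spec
  chart_mem_atlas _ := mem_range_self _

instance : IsManifold (𝓡 n) ∞ (RealProjectiveSpace n) := by
  refine isManifold_of_contDiffOn _ _ _ ?_
  rintro _ _ ⟨i, rfl⟩ ⟨k, rfl⟩
  have key : ∀ y : EuclideanSpace ℝ (Fin n),
      ((affineChart i).symm.trans (affineChart k)) y
        = WithLp.toLp 2 fun j => (affineVec i y).1 (k.succAbove j) / (affineVec i y).1 k :=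
    fun _ => rfl
  have hvec : ∀ l, ContDiff ℝ ∞ fun y : EuclideanSpace ℝ (Fin n) => (affineVec i y).1 l := by
    intro l
    refine Fin.succAboveCases i ?_ (fun j => ?_) l
    · simpa [affineVec] using contDiff_const
    · simp only [affineVec, Fin.insertNth_apply_succAbove]
      fun_prop
  simp only [modelWithCornersSelf_coe, modelWithCornersSelf_coe_symm, Function.comp_def, id,
    range_id, inter_univ]
  refine ContDiffOn.congr ?_ fun y _ => key y
  rw [contDiffOn_euclidean]
  intro j
  refine ContDiffOn.div (hvec _).contDiffOn (hvec _).contDiffOn fun y hy => ?_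
  exact hy.2

end RealProjectiveSpace

/-- A subset `X` of a finite-dimensional real vector space `V` is a submanifold diffeomorphic
to the manifold `M`: it is the image of a smooth embedding `f` (a smooth map with injective
differentials which is a homeomorphism onto its image). The smooth structure of `V` is the one
transported from `ℝ^k` by a linear isomorphism; it does not depend on this isomorphism. -/
def IsDiffeomorphicTo {V : Type*} [AddCommGroup V] [Module ℝ V] (X : Set V) {n : ℕ}
    (M : Type*) [TopologicalSpace M] [ChartedSpace (EuclideanSpace ℝ (Fin n)) M]
    [IsManifold (𝓡 n) ∞ M] : Prop :=
  ∃ (k : ℕ) (L : V ≃ₗ[ℝ] EuclideanSpace ℝ (Fin k)) (f : M → V),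
    ContMDiff (𝓡 n) (𝓡 k) ∞ (L ∘ f) ∧
    (∀ x, Function.Injective (mfderiv (𝓡 n) (𝓡 k) (L ∘ f) x)) ∧
    IsEmbedding (L ∘ f) ∧
    range f = X

/-! ### Minkowski space, its bivectors and the light cone -/

/-- The underlying vector space of Minkowski `4`-space. -/
abbrev Minkowski : Type := Fin 4 → ℝ

/-- The signs `(1, 1, 1, -1)` of the Minkowski metric. -/
def minkowskiSign : Fin 4 → ℝ := ![1, 1, 1, -1]

/-- The Minkowski metric `x¹y¹ + x²y² + x³y³ - x⁴y⁴`. -/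
def minkowskiForm (x y : Minkowski) : ℝ := ∑ i, minkowskiSign i * x i * y i

/-- `(e₁, e₂, e₃, e₄)` is a pseudo-orthonormal basis giving the orientation, with `e₁, e₂, e₃`
space-like and `e₄` time-like. -/
structure IsOrientedPseudoOrthonormal (e : Basis (Fin 4) ℝ Minkowski) : Prop where
  form_eq : ∀ i j, minkowskiForm (e i) (e j) = if i = j then minkowskiSign i else 0
  det_pos : 0 < (Pi.basisFun ℝ (Fin 4)).det e

/-- The space of bivectors, the second exterior power of Minkowski space. -/
abbrev Bivector : Type := ⋀[ℝ]^2 Minkowski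

/-- The bivector `x ∧ y`. -/
def wedge (x y : Minkowski) : Bivector := exteriorPower.ιMulti ℝ 2 ![x, y]

/-- The two-element index set `{i, j}`. -/
def pairIndex (i j : Fin 4) (h : i < j) : powersetCard (Fin 4) 2 :=
  ⟨{i, j}, Finset.card_pair h.ne⟩

/-- The basis vector of the space of bivectors with index `{i, j}`, `i < j`, is `e_i ∧ e_j`. -/
theorem exteriorPower_basis_pairIndex (e : Basis (Fin 4) ℝ Minkowski) (i j : Fin 4)
    (h : i < j) : e.exteriorPower 2 (pairIndex i j h) = wedge (e i) (e j) := by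
  rw [exteriorPower.coe_basis, wedge, exteriorPower.ιMulti_family]
  congr 1
  have hm : StrictMono ![i, j] := by
    intro a b hab
    fin_cases a <;> fin_cases b <;> simp_all
  have hs : ∀ x, ![i, j] x ∈ (pairIndex i j h).1 := by
    intro x
    fin_cases x <;> simp [pairIndex]
  have hk := Finset.orderEmbOfFin_unique (pairIndex i j h).2 hs hm
  funext k
  rw [Function.comp_apply, powersetCard.ofFinEmbEquiv_symm_apply, ← hk]
  fin_cases k <;> rfl

/-- The coordinate `c_{ij}`, `i < j`, of a bivector in the basis `e_i ∧ e_j`. -/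
def bivectorCoord (e : Basis (Fin 4) ℝ Minkowski) (i j : Fin 4) (Ω : Bivector)
    (h : i < j := by decide) : ℝ :=
  (e.exteriorPower 2).repr Ω (pairIndex i j h)

/-- `A(Ω)`: the sum of the squares of the coordinates `c₁₂, c₁₃, c₂₃` of `Ω`. -/
def spacePart (e : Basis (Fin 4) ℝ Minkowski) (Ω : Bivector) : ℝ :=
  bivectorCoord e 0 1 Ω ^ 2 + bivectorCoord e 0 2 Ω ^ 2 + bivectorCoord e 1 2 Ω ^ 2

/-- `B(Ω)`: the sum of the squares of the coordinates `c₁₄, c₂₄, c₃₄` of `Ω`. -/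
def timePart (e : Basis (Fin 4) ℝ Minkowski) (Ω : Bivector) : ℝ :=
  bivectorCoord e 0 3 Ω ^ 2 + bivectorCoord e 1 3 Ω ^ 2 + bivectorCoord e 2 3 Ω ^ 2

/-- The light cone of the space of bivectors. -/
def lightCone (e : Basis (Fin 4) ℝ Minkowski) : Set Bivector :=
  {Ω | spacePart e Ω = timePart e Ω ∧ timePart e Ω ≠ 0}

/-- The `r`-slice of the light cone with respect to `e`. -/
def rSlice (e : Basis (Fin 4) ℝ Minkowski) (r : ℝ) : Set Bivector :=
  {Ω ∈ lightCone e | spacePart e Ω = r ^ 2 ∧ timePart e Ω = r ^ 2}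

/-! ### The orbits of `SO(3,1)` -/

/-- The group `SO(3,1)`, as a set of matrices. -/
def SO31 : Set (Matrix (Fin 4) (Fin 4) ℝ) :=
  {P | P.transpose * Matrix.diagonal minkowskiSign * P = Matrix.diagonal minkowskiSign ∧
    P.det = 1}

/-- The `SO(3,1)`-orbit of a bivector, where `P` acts by `x ∧ y ↦ P x ∧ P y`. -/
def bivectorOrbit (Ω : Bivector) : Set Bivector :=
  {Ω' | ∃ P ∈ SO31, exteriorPower.map 2 (Matrix.toLin' P) Ω = Ω'}

/-- `√2 ((cos φ) u₁ ∧ u₂ + (sin φ) u₂ ∧ u₃ + u₃ ∧ u₄)`. -/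
def bivectorOf (u : Basis (Fin 4) ℝ Minkowski) (φ : ℝ) : Bivector :=
  √2 • (Real.cos φ • wedge (u 0) (u 1) + Real.sin φ • wedge (u 1) (u 2) + wedge (u 2) (u 3))

/-- The intersection of the orbit with the `r`-slice. The slice is taken with respect to `e`, the
bivector generating the orbit has the normal form above with respect to `u`. -/
def orbitSlice (e u : Basis (Fin 4) ℝ Minkowski) (φ r : ℝ) : Set Bivector :=
  bivectorOrbit (bivectorOf u φ) ∩ rSlice e r

/-- The threshold `r(φ)`. -/
def sliceThreshold (e u : Basis (Fin 4) ℝ Minkowski) (φ : ℝ) : ℝ :=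
  sInf {r | 0 < r ∧ (orbitSlice e u φ r).Nonempty}

/-- The number `t(φ)`, used for `φ ∈ [0, π] \ {π/2}`. -/
def tParam (φ : ℝ) : ℝ :=
  if φ < Real.pi / 2 then Real.artanh (Real.tan (φ / 2)) else Real.artanh (Real.cot (φ / 2))

end

/-!
In the basis `e_i ∧ e_j` a bivector `Ω` is a pair `(a, b)` of vectors of `ℝ³`, with
`a = (c₂₃, -c₁₃, c₁₂)` and `b = (c₁₄, c₂₄, c₃₄)`. Then `A(Ω) = ‖a‖²`, `B(Ω) = ‖b‖²`, and the
Pfaffian of `Ω` is `⟨a, b⟩`. The group `SO(3,1)` preserves `A - B` and the Pfaffian, and `Ω_φ` has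
`A = B = 2` and Pfaffian `2 cos φ`. Conversely, for `cos φ ≠ 0` these two invariants determine the
orbit: by a rotation and a boost every light-like bivector with Pfaffian `c ≠ 0` is moved to
`√|c| (∂₁ ∧ ∂₂ ± ∂₃ ∧ ∂₄)` (`mem_orbit_canonicalBivector`). Hence the slice of radius `r` of the
orbit is the set of pairs `(a, b)` with `‖a‖ = ‖b‖ = r` and `⟨a, b⟩ = 2 cos φ`
(`orbitSlice_eq_preimage`). By the Cauchy-Schwarz inequality it is nonempty if and only if
`2 |cos φ| ≤ r²`, which gives `r(φ) = √(2 |cos φ|)` (`sliceThreshold_eq`); the formula with `t(φ)`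
is the half-angle formula for the cosine.

In the case of equality, `b = ± a` with `a` in a sphere (`isDiffeomorphicTo_sphere`). If
`2 |cos φ| < r²`, then `a + b` and `a - b` are orthogonal vectors with prescribed positive lengths,
so that the slice is the set of the pairs of the first two columns of the matrices in `SO(3)`,
which is parametrized by the lines of quaternions (`isDiffeomorphicTo_realProjectiveSpace`).
The orthogonal projection `v vᵀ / |v|²` onto the line of the quaternion `v` is a polynomial function
of the rotation matrix (`shepperdMatrix`). This left inverse shows that the parametrization by
`ℝP³` is injective and immersive, and it provides the preimages (`shepperdMatrix_mul`).
-/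

/-! ### The group `SO(3,1)` and oriented pseudo-orthonormal bases -/

theorem one_mem_SO31 : (1 : Matrix (Fin 4) (Fin 4) ℝ) ∈ SO31 := by
  simp [SO31]

theorem mul_mem_SO31 {P Q : Matrix (Fin 4) (Fin 4) ℝ} (hP : P ∈ SO31) (hQ : Q ∈ SO31) :
    P * Q ∈ SO31 := by
  refine ⟨?_, by rw [Matrix.det_mul, hP.2, hQ.2, one_mul]⟩
  calc (P * Q).transpose * Matrix.diagonal minkowskiSign * (P * Q)
      = Q.transpose * (P.transpose * Matrix.diagonal minkowskiSign * P) * Q := by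
        simp only [Matrix.transpose_mul, Matrix.mul_assoc]
    _ = _ := by rw [hP.1, hQ.1]

theorem inv_mem_SO31 {P : Matrix (Fin 4) (Fin 4) ℝ} (hP : P ∈ SO31) : P⁻¹ ∈ SO31 := by
  have hu : IsUnit P.det := by rw [hP.2]; exact isUnit_one
  refine ⟨?_, by rw [Matrix.det_nonsing_inv, hP.2, Ring.inverse_one]⟩
  have hT : (P⁻¹).transpose * P.transpose = 1 := by
    rw [← Matrix.transpose_mul, Matrix.mul_nonsing_inv P hu, Matrix.transpose_one]
  calc (P⁻¹).transpose * Matrix.diagonal minkowskiSign * P⁻¹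
      = (P⁻¹).transpose * (P.transpose * Matrix.diagonal minkowskiSign * P) * P⁻¹ := by
        rw [hP.1]
    _ = ((P⁻¹).transpose * P.transpose) * Matrix.diagonal minkowskiSign * (P * P⁻¹) := by
        simp only [Matrix.mul_assoc]
    _ = _ := by rw [hT, Matrix.mul_nonsing_inv P hu, one_mul, mul_one]

/-- The matrix whose columns are the vectors of `e`. -/
noncomputable def basisMatrix (e : Basis (Fin 4) ℝ Minkowski) : Matrix (Fin 4) (Fin 4) ℝ :=
  Matrix.of fun i j => e j i

theorem IsOrientedPseudoOrthonormal.basisMatrix_mem_SO31 {e : Basis (Fin 4) ℝ Minkowski}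
    (he : IsOrientedPseudoOrthonormal e) : basisMatrix e ∈ SO31 := by
  have h1 : (basisMatrix e).transpose * Matrix.diagonal minkowskiSign * basisMatrix e
      = Matrix.diagonal minkowskiSign := by
    ext i j
    have h := he.form_eq i j
    rw [Matrix.diagonal_apply, ← h, minkowskiForm, Matrix.mul_apply]
    refine Finset.sum_congr rfl fun k _ => ?_
    rw [Matrix.mul_diagonal]
    simp only [basisMatrix, Matrix.transpose_apply, Matrix.of_apply]
    ring
  refine ⟨h1, ?_⟩
  have hpos : 0 < (basisMatrix e).det := by
    have h := he.det_pos
    rw [Basis.det_apply] at h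
    convert h using 2
    ext i j
    simp [basisMatrix, Basis.toMatrix_apply]
  have h2 := congrArg Matrix.det h1
  rw [Matrix.det_mul, Matrix.det_mul, Matrix.det_transpose, Matrix.det_diagonal,
    Fin.prod_univ_four] at h2
  simp only [minkowskiSign, Matrix.cons_val] at h2
  nlinarith

/-- If `E` has the vectors of `e` as columns, the coordinates in `e` of the `j`-th column of
`E * Q` form the `j`-th column of `Q`. -/
theorem repr_col_basisMatrix_mul (e : Basis (Fin 4) ℝ Minkowski) (Q : Matrix (Fin 4) (Fin 4) ℝ)
    (i j : Fin 4) : e.repr ((basisMatrix e * Q).col j) i = Q i j := by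
  have : (basisMatrix e * Q).col j = ∑ k, Q k j • e k := by
    ext l
    simp [Matrix.col, Matrix.mul_apply, basisMatrix, mul_comm]
  rw [this, e.repr_sum_self]

theorem toLin'_basis (P : Matrix (Fin 4) (Fin 4) ℝ) (u : Basis (Fin 4) ℝ Minkowski) (j : Fin 4) :
    Matrix.toLin' P (u j) = (P * basisMatrix u).col j := by
  ext l
  simp [Matrix.col, Matrix.mul_apply, basisMatrix, Matrix.mulVec, dotProduct]

/-! ### Coordinates of bivectors -/

theorem map_wedge (f : Minkowski →ₗ[ℝ] Minkowski) (x y : Minkowski) :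
    exteriorPower.map 2 f (wedge x y) = wedge (f x) (f y) := by
  rw [wedge, exteriorPower.map_apply_ιMulti, wedge]
  congr 1
  funext i
  fin_cases i <;> rfl

theorem bivectorCoord_wedge (e : Basis (Fin 4) ℝ Minkowski) (i j : Fin 4) (h : i < j)
    (x y : Minkowski) : bivectorCoord e i j (wedge x y) h
      = e.repr x i * e.repr y j - e.repr x j * e.repr y i := by
  have hm : StrictMono ![i, j] := by
    intro a b hab
    fin_cases a <;> fin_cases b <;> simp_all
  have hs : ∀ x, ![i, j] x ∈ (pairIndex i j h).1 := by
    intro x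
    fin_cases x <;> simp [pairIndex]
  have hk := Finset.orderEmbOfFin_unique (pairIndex i j h).2 hs hm
  rw [bivectorCoord, wedge, exteriorPower.basis_repr_apply, exteriorPower.ιMultiDual_apply_ιMulti,
    Matrix.det_fin_two]
  simp only [Matrix.of_apply, powersetCard.ofFinEmbEquiv_symm_apply]
  have h0 : (Finset.orderEmbOfFin (pairIndex i j h).1 (pairIndex i j h).2) 0 = i := by
    exact (congrFun hk 0).symm
  have h1 : (Finset.orderEmbOfFin (pairIndex i j h).1 (pairIndex i j h).2) 1 = j := by
    exact (congrFun hk 1).symm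
  erw [h0, h1]
  simp

theorem bivectorCoord_add (e : Basis (Fin 4) ℝ Minkowski) (i j : Fin 4) (h : i < j)
    (Ω Ω' : Bivector) :
    bivectorCoord e i j (Ω + Ω') h = bivectorCoord e i j Ω h + bivectorCoord e i j Ω' h := by
  simp [bivectorCoord]

theorem bivectorCoord_smul (e : Basis (Fin 4) ℝ Minkowski) (i j : Fin 4) (h : i < j)
    (t : ℝ) (Ω : Bivector) :
    bivectorCoord e i j (t • Ω) h = t * bivectorCoord e i j Ω h := by
  simp [bivectorCoord]

theorem exists_eq_pairIndex (s : powersetCard (Fin 4) 2) : ∃ i j, ∃ h : i < j,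
    s = pairIndex i j h := by
  obtain ⟨i, j, hij, hs⟩ := Finset.card_eq_two.1 s.2
  rcases lt_or_gt_of_ne hij with h | h
  · exact ⟨i, j, h, Subtype.ext hs⟩
  · exact ⟨j, i, h, Subtype.ext (hs.trans (Finset.pair_comm i j))⟩

theorem bivector_ext (e : Basis (Fin 4) ℝ Minkowski) {Ω Ω' : Bivector}
    (h : ∀ i j (hij : i < j), bivectorCoord e i j Ω hij = bivectorCoord e i j Ω' hij) :
    Ω = Ω' := by
  refine (e.exteriorPower 2).ext_elem fun s => ?_
  obtain ⟨i, j, hij, rfl⟩ := exists_eq_pairIndex s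
  exact h i j hij

/-- The linear map `Ω ↦ (a, b)` with `a = (c₂₃, -c₁₃, c₁₂)` and `b = (c₁₄, c₂₄, c₃₄)`,
given by the coordinates of `Ω` in the basis `e_i ∧ e_j`. With these signs `a` and `b` both
transform like vectors of Euclidean `3`-space under the rotations fixing `e₄`. -/
noncomputable def bivectorMap (e : Basis (Fin 4) ℝ Minkowski) :
    Bivector →ₗ[ℝ] EuclideanSpace ℝ (Fin 6) :=
  IsLinearMap.mk' (fun Ω => !₂[bivectorCoord e 1 2 Ω, -bivectorCoord e 0 2 Ω,
      bivectorCoord e 0 1 Ω, bivectorCoord e 0 3 Ω, bivectorCoord e 1 3 Ω, bivectorCoord e 2 3 Ω])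
    { map_add := fun Ω Ω' => by
        simp only [bivectorCoord_add, neg_add]
        ext i
        fin_cases i <;> rfl
      map_smul := fun t Ω => by
        simp only [bivectorCoord_smul]
        ext i
        fin_cases i <;> simp }

theorem bivectorMap_injective (e : Basis (Fin 4) ℝ Minkowski) :
    Function.Injective (bivectorMap e) := by
  intro Ω Ω' h
  have h' : ∀ i, bivectorMap e Ω i = bivectorMap e Ω' i := fun i => by rw [h]
  have h0 : bivectorCoord e 1 2 Ω = bivectorCoord e 1 2 Ω' := h' 0
  have h1 : bivectorCoord e 0 2 Ω = bivectorCoord e 0 2 Ω' := neg_injective (h' 1)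
  have h2 : bivectorCoord e 0 1 Ω = bivectorCoord e 0 1 Ω' := h' 2
  have h3 : bivectorCoord e 0 3 Ω = bivectorCoord e 0 3 Ω' := h' 3
  have h4 : bivectorCoord e 1 3 Ω = bivectorCoord e 1 3 Ω' := h' 4
  have h5 : bivectorCoord e 2 3 Ω = bivectorCoord e 2 3 Ω' := h' 5
  refine bivector_ext e fun i j hij => ?_
  fin_cases i <;> fin_cases j <;> first | exact absurd hij (by decide) | assumption

/-- The map `Ω ↦ (a, b)` as a linear isomorphism. -/
noncomputable def bivectorEquiv (e : Basis (Fin 4) ℝ Minkowski) :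
    Bivector ≃ₗ[ℝ] EuclideanSpace ℝ (Fin 6) :=
  LinearEquiv.ofInjectiveOfFinrankEq (bivectorMap e) (bivectorMap_injective e) (by
    rw [exteriorPower.finrank_eq, finrank_fin_fun, finrank_euclideanSpace_fin]
    decide)

theorem bivectorEquiv_apply (e : Basis (Fin 4) ℝ Minkowski) (Ω : Bivector) :
    bivectorEquiv e Ω = !₂[bivectorCoord e 1 2 Ω, -bivectorCoord e 0 2 Ω, bivectorCoord e 0 1 Ω,
        bivectorCoord e 0 3 Ω, bivectorCoord e 1 3 Ω, bivectorCoord e 2 3 Ω] := rfl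

/-! ### The quadratic invariants and the orbits -/

/-- The Pfaffian `c₁₂ c₃₄ - c₁₃ c₂₄ + c₁₄ c₂₃`, the coefficient of `Ω ∧ Ω / 2`. -/
noncomputable def pfaffian (e : Basis (Fin 4) ℝ Minkowski) (Ω : Bivector) : ℝ :=
  bivectorCoord e 0 1 Ω * bivectorCoord e 2 3 Ω - bivectorCoord e 0 2 Ω * bivectorCoord e 1 3 Ω
    + bivectorCoord e 0 3 Ω * bivectorCoord e 1 2 Ω

/-- The Pfaffian is constant along orbits, since it is multiplied by the determinant. -/
theorem pfaffian_of_mem_orbit {e u : Basis (Fin 4) ℝ Minkowski}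
    (he : IsOrientedPseudoOrthonormal e) (hu : IsOrientedPseudoOrthonormal u) {φ : ℝ}
    {Ω : Bivector} (h : Ω ∈ bivectorOrbit (bivectorOf u φ)) :
    pfaffian e Ω = 2 * Real.cos φ := by
  obtain ⟨P, hP, rfl⟩ := h
  have hE := he.basisMatrix_mem_SO31
  -- `Q` is the matrix of the coordinates of the vectors `P u_j` in the basis `e`
  obtain ⟨Q, hQ, hPQ⟩ : ∃ Q ∈ SO31, P * basisMatrix u = basisMatrix e * Q := by
    refine ⟨(basisMatrix e)⁻¹ * (P * basisMatrix u),
      mul_mem_SO31 (inv_mem_SO31 hE) (mul_mem_SO31 hP hu.basisMatrix_mem_SO31), ?_⟩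
    rw [Matrix.mul_nonsing_inv_cancel_left]
    rw [hE.2]; exact isUnit_one
  have hd := hQ.2
  rw [Matrix.det_succ_row_zero] at hd
  simp [Fin.sum_univ_succ, Matrix.det_fin_three, Fin.succAbove] at hd
  have h2 : √2 ^ 2 = (2 : ℝ) := Real.sq_sqrt (by norm_num)
  simp only [bivectorOf, map_add, map_smul, map_wedge, toLin'_basis, hPQ, pfaffian,
    bivectorCoord_add, bivectorCoord_smul, bivectorCoord_wedge, repr_col_basisMatrix_mul]
  trans √2 ^ 2 * Real.cos φ * 1
  · rw [← hd]; ring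
  · rw [h2]; ring

theorem exists_unit_perp (q₁ q₂ q₃ : ℝ) :
    ∃ p₁ p₂ p₃ : ℝ, p₁ ^ 2 + p₂ ^ 2 + p₃ ^ 2 = 1 ∧ p₁ * q₁ + p₂ * q₂ + p₃ * q₃ = 0 := by
  by_cases h : q₁ ^ 2 + q₂ ^ 2 = 0
  · have h1 : q₁ = 0 := by nlinarith [sq_nonneg q₁, sq_nonneg q₂]
    exact ⟨1, 0, 0, by norm_num, by simp [h1]⟩
  · have hpos : 0 < q₁ ^ 2 + q₂ ^ 2 := lt_of_le_of_ne (by positivity) (Ne.symm h)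
    have hs := Real.sq_sqrt hpos.le
    have hs0 : √(q₁ ^ 2 + q₂ ^ 2) ≠ 0 := (Real.sqrt_pos.2 hpos).ne'
    refine ⟨-q₂ / √(q₁ ^ 2 + q₂ ^ 2), q₁ / √(q₁ ^ 2 + q₂ ^ 2), 0, ?_, ?_⟩
    · rw [div_pow, div_pow, hs]
      field_simp
      ring
    · ring

/-- A vector `v` orthogonal to `q` is a multiple, with a prescribed factor `s` of
absolute value `‖v‖`, of a unit vector orthogonal to `q`, even if `v = 0`. -/
theorem exists_unit_perp_smul_eq {q₁ q₂ q₃ v₁ v₂ v₃ s : ℝ}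
    (hv : v₁ * q₁ + v₂ * q₂ + v₃ * q₃ = 0) (hs : s ^ 2 = v₁ ^ 2 + v₂ ^ 2 + v₃ ^ 2) :
    ∃ p₁ p₂ p₃ : ℝ, p₁ ^ 2 + p₂ ^ 2 + p₃ ^ 2 = 1 ∧ p₁ * q₁ + p₂ * q₂ + p₃ * q₃ = 0 ∧
      v₁ = s * p₁ ∧ v₂ = s * p₂ ∧ v₃ = s * p₃ := by
  by_cases h : s = 0
  · obtain ⟨p₁, p₂, p₃, hp, hpq⟩ := exists_unit_perp q₁ q₂ q₃
    subst h
    refine ⟨p₁, p₂, p₃, hp, hpq, ?_, ?_, ?_⟩ <;>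
      nlinarith [sq_nonneg v₁, sq_nonneg v₂, sq_nonneg v₃]
  · refine ⟨v₁ / s, v₂ / s, v₃ / s, ?_, ?_, ?_, ?_, ?_⟩
    · rw [div_pow, div_pow, div_pow, ← add_div, ← add_div, ← hs, div_self (pow_ne_zero 2 h)]
    · rw [div_mul_eq_mul_div, div_mul_eq_mul_div, div_mul_eq_mul_div, ← add_div, ← add_div, hv,
        zero_div]
    all_goals field_simp

/-- A boost in the plane of the first and the last axis, followed by the rotation that maps the
space-like axes to `p × q`, `p`, `q`, is in `SO(3,1)`. -/
theorem boostFrame_mem_SO31 {p₁ p₂ p₃ q₁ q₂ q₃ C S : ℝ} (hp : p₁ ^ 2 + p₂ ^ 2 + p₃ ^ 2 = 1)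
    (hq : q₁ ^ 2 + q₂ ^ 2 + q₃ ^ 2 = 1) (hpq : p₁ * q₁ + p₂ * q₂ + p₃ * q₃ = 0)
    (hCS : C ^ 2 - S ^ 2 = 1) :
    !![C * (p₂ * q₃ - p₃ * q₂), p₁, q₁, S * (p₂ * q₃ - p₃ * q₂);
       C * (p₃ * q₁ - p₁ * q₃), p₂, q₂, S * (p₃ * q₁ - p₁ * q₃);
       C * (p₁ * q₂ - p₂ * q₁), p₃, q₃, S * (p₁ * q₂ - p₂ * q₁);
       S, 0, 0, C] ∈ SO31 := by
  have hm : (p₂ * q₃ - p₃ * q₂) ^ 2 + (p₃ * q₁ - p₁ * q₃) ^ 2 + (p₁ * q₂ - p₂ * q₁) ^ 2 = 1 := by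
    linear_combination (q₁ ^ 2 + q₂ ^ 2 + q₃ ^ 2) * hp + hq
      - (p₁ * q₁ + p₂ * q₂ + p₃ * q₃) * hpq
  refine ⟨?_, ?_⟩
  · ext i j
    fin_cases i <;> fin_cases j <;>
      simp [Matrix.mul_apply, Fin.sum_univ_four, minkowskiSign, Matrix.diagonal]
    · linear_combination C ^ 2 * hm + hCS
    · ring
    · ring
    · linear_combination C * S * hm
    · ring
    · linear_combination hp
    · linear_combination hpq
    · ring
    · ring
    · linear_combination hpq
    · linear_combination hq
    · ring
    · linear_combination C * S * hm
    · ring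
    · ring
    · linear_combination S ^ 2 * hm - hCS
  · rw [Matrix.det_succ_row_zero]
    simp [Fin.sum_univ_succ, Matrix.det_fin_three, Fin.succAbove]
    linear_combination (C ^ 2 - S ^ 2) * hm + hCS

/-- The bivector `√|c| (∂₁ ∧ ∂₂ ± ∂₃ ∧ ∂₄)`, where `±` is the sign of `c ≠ 0`. It is
light-like with Pfaffian `c` and represents the orbit of the bivectors with these properties. -/
noncomputable def canonicalBivector (c : ℝ) : Bivector :=
  √|c| • (wedge (Pi.basisFun ℝ (Fin 4) 0) (Pi.basisFun ℝ (Fin 4) 1)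
    + (c / |c|) • wedge (Pi.basisFun ℝ (Fin 4) 2) (Pi.basisFun ℝ (Fin 4) 3))

theorem basisMatrix_basisFun : basisMatrix (Pi.basisFun ℝ (Fin 4)) = 1 := by
  ext i j
  simp [basisMatrix, Matrix.one_apply, Pi.single_apply]

/-- With `ε` the sign of `c`, the vectors `a + ε b` and `a - ε b` are orthogonal. They give the
third and the second vector of an orthonormal frame of space, and a boost along the first one
reduces `Ω` to the canonical bivector. -/
theorem mem_orbit_canonicalBivector {e : Basis (Fin 4) ℝ Minkowski}
    (he : IsOrientedPseudoOrthonormal e) {Ω : Bivector} {c : ℝ} (hc : c ≠ 0)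
    (hAB : spacePart e Ω = timePart e Ω) (hpf : pfaffian e Ω = c) :
    Ω ∈ bivectorOrbit (canonicalBivector c) := by
  simp only [spacePart, timePart, pfaffian] at hAB hpf
  set a₁ := bivectorCoord e 1 2 Ω with ha₁
  obtain ⟨a₂, ha₂⟩ : ∃ a₂, bivectorCoord e 0 2 Ω = -a₂ := ⟨_, (neg_neg _).symm⟩
  set a₃ := bivectorCoord e 0 1 Ω with ha₃
  set b₁ := bivectorCoord e 0 3 Ω with hb₁
  set b₂ := bivectorCoord e 1 3 Ω with hb₂
  set b₃ := bivectorCoord e 2 3 Ω with hb₃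
  rw [ha₂] at hAB hpf
  obtain ⟨ρ, hρ⟩ : ∃ ρ, ρ = b₁ ^ 2 + b₂ ^ 2 + b₃ ^ 2 := ⟨_, rfl⟩
  have habs : 0 < |c| := abs_pos.2 hc
  obtain ⟨l, hl⟩ : ∃ l, l = √|c| := ⟨_, rfl⟩
  have hl2 : l ^ 2 = |c| := by rw [hl, Real.sq_sqrt habs.le]
  have hl0 : 0 < l := by rw [hl]; exact Real.sqrt_pos.2 habs
  obtain ⟨ε, hε⟩ : ∃ ε, ε = c / |c| := ⟨_, rfl⟩
  have hε2 : ε ^ 2 = 1 := by rw [hε, div_pow, sq_abs, div_self (pow_ne_zero 2 hc)]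
  have hεc : ε * c = |c| := by
    rw [hε, div_mul_eq_mul_div, ← sq, ← sq_abs, sq, mul_div_assoc, div_self habs.ne', mul_one]
  have hle : |c| ≤ ρ := by
    rw [abs_le]
    constructor
    · nlinarith [sq_nonneg (a₁ + b₁), sq_nonneg (a₂ + b₂), sq_nonneg (a₃ + b₃)]
    · nlinarith [sq_nonneg (a₁ - b₁), sq_nonneg (a₂ - b₂), sq_nonneg (a₃ - b₃)]
  have hρ0 : 0 < ρ := habs.trans_le hle
  -- `C` and `S` are the hyperbolic cosine and sine of the rapidity of the boost:
  -- `‖a + ε b‖ = 2 l C` and `‖a - ε b‖ = 2 l S`.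
  obtain ⟨C, hC0, hC⟩ : ∃ C, 0 < C ∧ 4 * l ^ 2 * C ^ 2 = 2 * (ρ + |c|) := by
    refine ⟨√((ρ + |c|) / (2 * |c|)), Real.sqrt_pos.2 (by positivity), ?_⟩
    rw [hl2, Real.sq_sqrt (by positivity)]
    field_simp
    ring
  obtain ⟨S, hS⟩ : ∃ S, 4 * l ^ 2 * S ^ 2 = 2 * (ρ - |c|) := by
    refine ⟨√((ρ - |c|) / (2 * |c|)), ?_⟩
    rw [hl2, Real.sq_sqrt (div_nonneg (sub_nonneg.2 hle) (by positivity))]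
    field_simp
    ring
  have hCS : C ^ 2 - S ^ 2 = 1 := by
    have : 4 * l ^ 2 * (C ^ 2 - S ^ 2 - 1) = 0 := by linear_combination hC - hS - 4 * hl2
    have h4 : 4 * l ^ 2 ≠ 0 := by positivity
    linarith [(mul_eq_zero.1 this).resolve_left h4]
  have hk : 2 * l * C ≠ 0 := by positivity
  obtain ⟨q₁, hq₁⟩ : ∃ q₁, a₁ + ε * b₁ = 2 * l * C * q₁ :=
    ⟨_, (mul_div_cancel₀ _ hk).symm⟩
  obtain ⟨q₂, hq₂⟩ : ∃ q₂, a₂ + ε * b₂ = 2 * l * C * q₂ :=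
    ⟨_, (mul_div_cancel₀ _ hk).symm⟩
  obtain ⟨q₃, hq₃⟩ : ∃ q₃, a₃ + ε * b₃ = 2 * l * C * q₃ :=
    ⟨_, (mul_div_cancel₀ _ hk).symm⟩
  have hq : q₁ ^ 2 + q₂ ^ 2 + q₃ ^ 2 = 1 := by
    have : (2 * l * C) ^ 2 * (q₁ ^ 2 + q₂ ^ 2 + q₃ ^ 2 - 1) = 0 := by
      have : (2 * l * C * q₁) ^ 2 + (2 * l * C * q₂) ^ 2 + (2 * l * C * q₃) ^ 2
          = 2 * (ρ + |c|) := by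
        rw [← hq₁, ← hq₂, ← hq₃]
        linear_combination hAB - 2 * hρ + 2 * ε * hpf + 2 * hεc
          + (b₁ ^ 2 + b₂ ^ 2 + b₃ ^ 2) * hε2
      linear_combination this - hC
    linarith [(mul_eq_zero.1 this).resolve_left (pow_ne_zero 2 hk)]
  have hv : (ε * a₁ - b₁) * q₁ + (ε * a₂ - b₂) * q₂ + (ε * a₃ - b₃) * q₃ = 0 := by
    refine (mul_eq_zero.1 (?_ : (2 * l * C) * _ = 0)).resolve_left hk
    linear_combination -(ε * a₁ - b₁) * hq₁ - (ε * a₂ - b₂) * hq₂ - (ε * a₃ - b₃) * hq₃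
      + ε * hAB + (a₁ * b₁ + a₂ * b₂ + a₃ * b₃) * hε2
  obtain ⟨p₁, p₂, p₃, hp, hpq, hp₁, hp₂, hp₃⟩ :=
    exists_unit_perp_smul_eq (s := 2 * l * S) hv (by
      linear_combination hS + 2 * hρ + 2 * ε * hpf - hAB + 2 * hεc
        - hε2 * (a₁ ^ 2 + a₂ ^ 2 + a₃ ^ 2))
  have ha1 : a₁ = l * (C * q₁ + ε * S * p₁) := by
    linear_combination (hq₁ + ε * hp₁ - a₁ * hε2) / 2
  have ha2 : a₂ = l * (C * q₂ + ε * S * p₂) := by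
    linear_combination (hq₂ + ε * hp₂ - a₂ * hε2) / 2
  have ha3 : a₃ = l * (C * q₃ + ε * S * p₃) := by
    linear_combination (hq₃ + ε * hp₃ - a₃ * hε2) / 2
  have hb1 : b₁ = l * (ε * C * q₁ - S * p₁) := by
    linear_combination (ε * hq₁ - hp₁ - b₁ * hε2) / 2
  have hb2 : b₂ = l * (ε * C * q₂ - S * p₂) := by
    linear_combination (ε * hq₂ - hp₂ - b₂ * hε2) / 2
  have hb3 : b₃ = l * (ε * C * q₃ - S * p₃) := by
    linear_combination (ε * hq₃ - hp₃ - b₃ * hε2) / 2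
  -- The columns `f_j` of the boost frame satisfy `Ω = l (f₁ ∧ f₂ + ε f₃ ∧ f₄)`, because
  -- `(p × q) × p = q` and `q × (p × q) = p`.
  have hQ := boostFrame_mem_SO31 hp hq hpq hCS
  refine ⟨_, mul_mem_SO31 he.basisMatrix_mem_SO31 hQ, ?_⟩
  simp only [canonicalBivector, map_smul, map_add, map_wedge, toLin'_basis, basisMatrix_basisFun,
    mul_one, ← hl, ← hε]
  refine bivector_ext e fun i j hij => ?_
  simp only [bivectorCoord_add, bivectorCoord_smul, bivectorCoord_wedge,
    repr_col_basisMatrix_mul]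
  fin_cases i <;> fin_cases j <;> try exact absurd hij (by decide)
  · simp
    rw [← ha₃, ha3]
    linear_combination l * C * (q₃ * hp - p₃ * hpq) + l * ε * S * (p₃ * hq - q₃ * hpq)
  · simp
    rw [ha₂, ha2]
    linear_combination -(l * C * (q₂ * hp - p₂ * hpq) + l * ε * S * (p₂ * hq - q₂ * hpq))
  · simp
    rw [← hb₁, hb1]
    ring
  · simp
    rw [← ha₁, ha1]
    linear_combination l * C * (q₁ * hp - p₁ * hpq) + l * ε * S * (p₁ * hq - q₁ * hpq)
  · simp
    rw [← hb₂, hb2]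
    ring
  · simp
    rw [← hb₃, hb3]
    ring

theorem bivectorOrbit_symm {Ω Ω' : Bivector} (h : Ω' ∈ bivectorOrbit Ω) :
    Ω ∈ bivectorOrbit Ω' := by
  obtain ⟨P, hP, rfl⟩ := h
  refine ⟨P⁻¹, inv_mem_SO31 hP, ?_⟩
  rw [← LinearMap.comp_apply, ← exteriorPower.map_comp, ← Matrix.toLin'_mul,
    Matrix.nonsing_inv_mul P (by rw [hP.2]; exact isUnit_one), Matrix.toLin'_one,
    exteriorPower.map_id, LinearMap.id_apply]

theorem bivectorOrbit_trans {Ω Ω' Ω'' : Bivector} (h : Ω' ∈ bivectorOrbit Ω)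
    (h' : Ω'' ∈ bivectorOrbit Ω') : Ω'' ∈ bivectorOrbit Ω := by
  obtain ⟨P, hP, rfl⟩ := h
  obtain ⟨P', hP', rfl⟩ := h'
  refine ⟨P' * P, mul_mem_SO31 hP' hP, ?_⟩
  rw [← LinearMap.comp_apply, ← exteriorPower.map_comp, ← Matrix.toLin'_mul]

theorem mem_bivectorOrbit_self (Ω : Bivector) : Ω ∈ bivectorOrbit Ω :=
  ⟨1, one_mem_SO31, by rw [Matrix.toLin'_one, exteriorPower.map_id, LinearMap.id_apply]⟩

theorem spacePart_bivectorOf (u : Basis (Fin 4) ℝ Minkowski) (φ : ℝ) :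
    spacePart u (bivectorOf u φ) = 2 := by
  simp only [spacePart, bivectorOf, bivectorCoord_add, bivectorCoord_smul, bivectorCoord_wedge,
    Basis.repr_self, Finsupp.single_apply]
  simp [mul_pow]
  linear_combination 2 * Real.sin_sq_add_cos_sq φ

theorem timePart_bivectorOf (u : Basis (Fin 4) ℝ Minkowski) (φ : ℝ) :
    timePart u (bivectorOf u φ) = 2 := by
  simp only [timePart, bivectorOf, bivectorCoord_add, bivectorCoord_smul, bivectorCoord_wedge,
    Basis.repr_self, Finsupp.single_apply]
  simp

/-- The slices of the orbit are cut out by the quadratic invariants. Invariance of `A - B` is not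
needed, since `A` and `B` are prescribed on the slice. -/
theorem mem_orbitSlice_iff {e u : Basis (Fin 4) ℝ Minkowski} (he : IsOrientedPseudoOrthonormal e)
    (hu : IsOrientedPseudoOrthonormal u) {φ r : ℝ} (hφ : Real.cos φ ≠ 0) (hr : 0 < r)
    (Ω : Bivector) : Ω ∈ orbitSlice e u φ r ↔
      spacePart e Ω = r ^ 2 ∧ timePart e Ω = r ^ 2 ∧ pfaffian e Ω = 2 * Real.cos φ := by
  constructor
  · rintro ⟨h, -, hA, hB⟩
    exact ⟨hA, hB, pfaffian_of_mem_orbit he hu h⟩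
  · rintro ⟨hA, hB, hpf⟩
    have hc : 2 * Real.cos φ ≠ 0 := mul_ne_zero two_ne_zero hφ
    refine ⟨?_, ⟨hA.trans hB.symm, ?_⟩, hA, hB⟩
    · refine bivectorOrbit_trans (bivectorOrbit_symm ?_)
        (mem_orbit_canonicalBivector he hc (hA.trans hB.symm) hpf)
      exact mem_orbit_canonicalBivector hu hc
        ((spacePart_bivectorOf u φ).trans (timePart_bivectorOf u φ).symm)
        (pfaffian_of_mem_orbit hu hu (mem_bivectorOrbit_self _))
    · rw [hB]
      positivity

/-! ### Slices as sets of pairs of vectors -/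

/-- The pairs `(a, b)` of vectors of `ℝ³` with `‖a‖ = ‖b‖ = r` and `⟨a, b⟩ = c`. -/
def vectorPairs (r c : ℝ) : Set (EuclideanSpace ℝ (Fin 6)) :=
  {w | w 0 ^ 2 + w 1 ^ 2 + w 2 ^ 2 = r ^ 2 ∧ w 3 ^ 2 + w 4 ^ 2 + w 5 ^ 2 = r ^ 2 ∧
    w 0 * w 3 + w 1 * w 4 + w 2 * w 5 = c}

theorem orbitSlice_eq_preimage {e u : Basis (Fin 4) ℝ Minkowski}
    (he : IsOrientedPseudoOrthonormal e) (hu : IsOrientedPseudoOrthonormal u) {φ r : ℝ}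
    (hφ : Real.cos φ ≠ 0) (hr : 0 < r) :
    orbitSlice e u φ r = bivectorEquiv e ⁻¹' vectorPairs r (2 * Real.cos φ) := by
  ext Ω
  rw [mem_orbitSlice_iff he hu hφ hr, mem_preimage, bivectorEquiv_apply, vectorPairs, mem_ofPred_eq]
  simp only [Matrix.cons_val, spacePart, timePart, pfaffian]
  constructor <;> rintro ⟨h1, h2, h3⟩ <;>
    exact ⟨by linear_combination h1, by linear_combination h2, by linear_combination h3⟩

/-- Being diffeomorphic to `M` can be checked after a linear isomorphism `L` to a Euclidean
space. -/
theorem isDiffeomorphicTo_preimage {V : Type*} [AddCommGroup V] [Module ℝ V] {k n : ℕ}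
    (L : V ≃ₗ[ℝ] EuclideanSpace ℝ (Fin k)) {M : Type*} [TopologicalSpace M]
    [ChartedSpace (EuclideanSpace ℝ (Fin n)) M] [IsManifold (𝓡 n) ∞ M]
    {S : Set (EuclideanSpace ℝ (Fin k))} (F : M → EuclideanSpace ℝ (Fin k))
    (hF : ContMDiff (𝓡 n) (𝓡 k) ∞ F)
    (hF' : ∀ x, Function.Injective (mfderiv (𝓡 n) (𝓡 k) F x)) (hemb : IsEmbedding F)
    (hS : range F = S) : IsDiffeomorphicTo (L ⁻¹' S) (n := n) M := by
  have h : L ∘ (L.symm ∘ F) = F := by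
    ext1 x
    simp
  refine ⟨k, L, L.symm ∘ F, by rwa [h], by rwa [h], by rwa [h], ?_⟩
  rw [range_comp, hS]
  exact L.symm.toEquiv.image_eq_preimage_symm S

/-! ### The sphere as a set of pairs of parallel vectors -/

/-- The linear map `x ↦ (r x, ε r x)` from `ℝ³` to `ℝ⁶`. -/
noncomputable def diagonalMap (r ε : ℝ) :
    EuclideanSpace ℝ (Fin 3) →ₗ[ℝ] EuclideanSpace ℝ (Fin 6) :=
  IsLinearMap.mk' (fun x => !₂[r * x 0, r * x 1, r * x 2, ε * r * x 0, ε * r * x 1, ε * r * x 2])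
    { map_add := fun x y => by
        ext i
        fin_cases i <;> simp [mul_add]
      map_smul := fun t x => by
        ext i
        fin_cases i <;> simp [mul_left_comm] }

theorem diagonalMap_injective {r : ℝ} (hr : r ≠ 0) (ε : ℝ) :
    Function.Injective (diagonalMap r ε) := by
  intro x y h
  have h' : ∀ i, diagonalMap r ε x i = diagonalMap r ε y i := fun i => by rw [h]
  have h0 : r * x 0 = r * y 0 := h' 0
  have h1 : r * x 1 = r * y 1 := h' 1
  have h2 : r * x 2 = r * y 2 := h' 2
  ext i
  fin_cases i
  · exact mul_left_cancel₀ hr h0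
  · exact mul_left_cancel₀ hr h1
  · exact mul_left_cancel₀ hr h2

/-- Equality in the Cauchy-Schwarz inequality: the pairs are `(a, ε a)` with `ε = ±1`. -/
theorem isDiffeomorphicTo_sphere {V : Type*} [AddCommGroup V] [Module ℝ V]
    (L : V ≃ₗ[ℝ] EuclideanSpace ℝ (Fin 6)) {r c ε : ℝ} (hr : 0 < r) (hε : ε ^ 2 = 1)
    (hc : c = ε * r ^ 2) : IsDiffeomorphicTo (L ⁻¹' vectorPairs r c) (n := 2)
      (Metric.sphere (0 : EuclideanSpace ℝ (Fin 3)) 1) := by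
  have hinj := diagonalMap_injective hr.ne' ε
  obtain ⟨A, hA⟩ : ∃ A : EuclideanSpace ℝ (Fin 3) →L[ℝ] EuclideanSpace ℝ (Fin 6),
    ∀ x, A x = diagonalMap r ε x :=
      ⟨LinearMap.toContinuousLinearMap (diagonalMap r ε), fun _ => rfl⟩
  have hAinj : Function.Injective A := fun x y h => hinj (by rwa [← hA, ← hA])
  have hcoe : ContMDiff (𝓡 2) (𝓡 3) ∞
      ((↑) : Metric.sphere (0 : EuclideanSpace ℝ (Fin 3)) 1 → EuclideanSpace ℝ (Fin 3)) := by
    have := Fact.mk (@finrank_euclideanSpace_fin ℝ _ (2 + 1))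
    exact contMDiff_coe_sphere
  have hF : ContMDiff (𝓡 2) (𝓡 6) ∞
      (fun x : Metric.sphere (0 : EuclideanSpace ℝ (Fin 3)) 1 => A x) :=
    A.contDiff.contMDiff.comp hcoe
  refine isDiffeomorphicTo_preimage L (fun x => A x) hF (fun x => ?_) ?_ ?_
  · have h1 : mfderiv (𝓡 2) (𝓡 6)
        (A ∘ ((↑) : Metric.sphere (0 : EuclideanSpace ℝ (Fin 3)) 1 → EuclideanSpace ℝ (Fin 3))) x
        = (mfderiv (𝓡 3) (𝓡 6) A (x : EuclideanSpace ℝ (Fin 3))).comp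
          (mfderiv (𝓡 2) (𝓡 3) ((↑) : Metric.sphere (0 : EuclideanSpace ℝ (Fin 3)) 1 →
            EuclideanSpace ℝ (Fin 3)) x) :=
      mfderiv_comp x A.mdifferentiableAt (hcoe.mdifferentiableAt (by simp))
    have h2 : Function.Injective (mfderiv (𝓡 2) (𝓡 3)
        ((↑) : Metric.sphere (0 : EuclideanSpace ℝ (Fin 3)) 1 → EuclideanSpace ℝ (Fin 3)) x) := by
      have := Fact.mk (@finrank_euclideanSpace_fin ℝ _ (2 + 1))
      convert! injective_mvfderiv_subtypeVal_sphere x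
    have h3 : mfderiv (𝓡 3) (𝓡 6) A (x : EuclideanSpace ℝ (Fin 3)) = A := by
      rw [mfderiv_eq_fderiv]
      exact A.fderiv
    change Function.Injective (mfderiv (𝓡 2) (𝓡 6) (A ∘ (↑)) x)
    rw [h1, h3]
    exact hAinj.comp h2
  · exact (hF.continuous.isClosedEmbedding (hAinj.comp Subtype.val_injective)).isEmbedding
  · ext w
    constructor
    · rintro ⟨⟨x, hx⟩, rfl⟩
      rw [mem_sphere_zero_iff_norm, EuclideanSpace.norm_eq, Real.sqrt_eq_one,
        Fin.sum_univ_three] at hx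
      simp only [Real.norm_eq_abs, sq_abs] at hx
      have hw : A x = !₂[r * x 0, r * x 1, r * x 2, ε * r * x 0, ε * r * x 1, ε * r * x 2] :=
        hA x
      simp only [hw, vectorPairs, mem_ofPred_eq, Matrix.cons_val]
      refine ⟨by linear_combination r ^ 2 * hx, ?_, ?_⟩
      · linear_combination ε ^ 2 * r ^ 2 * hx + r ^ 2 * hε
      · linear_combination ε * r ^ 2 * hx - hc
    · rintro ⟨h1, h2, h3⟩
      -- `‖b - ε a‖² = 0`, so that `b = ε a`
      have hz : (w 3 - ε * w 0) ^ 2 + (w 4 - ε * w 1) ^ 2 + (w 5 - ε * w 2) ^ 2 = 0 := by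
        linear_combination h2 + ε ^ 2 * h1 - 2 * ε * h3 - 2 * ε * hc - r ^ 2 * hε
      have h30 : w 3 = ε * w 0 := by
        nlinarith [sq_nonneg (w 3 - ε * w 0), sq_nonneg (w 4 - ε * w 1), sq_nonneg (w 5 - ε * w 2)]
      have h41 : w 4 = ε * w 1 := by
        nlinarith [sq_nonneg (w 3 - ε * w 0), sq_nonneg (w 4 - ε * w 1), sq_nonneg (w 5 - ε * w 2)]
      have h52 : w 5 = ε * w 2 := by
        nlinarith [sq_nonneg (w 3 - ε * w 0), sq_nonneg (w 4 - ε * w 1), sq_nonneg (w 5 - ε * w 2)]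
      refine ⟨⟨!₂[w 0 / r, w 1 / r, w 2 / r], ?_⟩, ?_⟩
      · rw [mem_sphere_zero_iff_norm, EuclideanSpace.norm_eq, Real.sqrt_eq_one,
          Fin.sum_univ_three]
        simp only [Real.norm_eq_abs, sq_abs, Matrix.cons_val]
        rw [div_pow, div_pow, div_pow, ← add_div, ← add_div, h1, div_self (by positivity)]
      · change A !₂[w 0 / r, w 1 / r, w 2 / r] = w
        rw [hA]
        have hr' := hr.ne'
        ext i
        fin_cases i
        · change r * (w 0 / r) = w 0
          field_simp
        · change r * (w 1 / r) = w 1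
          field_simp
        · change r * (w 2 / r) = w 2
          field_simp
        · change ε * r * (w 0 / r) = w 3
          rw [h30]
          field_simp
        · change ε * r * (w 1 / r) = w 4
          rw [h41]
          field_simp
        · change ε * r * (w 2 / r) = w 5
          rw [h52]
          field_simp

/-! ### Rotations and quaternions -/

/-- The matrix `v vᵀ / |v|²` of the orthogonal projection onto the line spanned by `v ≠ 0`. -/
noncomputable def projMatrix (v : Fin 4 → ℝ) : Matrix (Fin 4) (Fin 4) ℝ :=
  Matrix.of fun i j => v i * v j / (v 0 ^ 2 + v 1 ^ 2 + v 2 ^ 2 + v 3 ^ 2)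

/-- The pair `(α x + β y, α x - β y)`, where `x` and `y` are the first two columns of the rotation
given by a unit quaternion `v`, as a linear function of `T = v vᵀ`. -/
noncomputable def rotationPair (α β : ℝ) (T : Matrix (Fin 4) (Fin 4) ℝ) :
    EuclideanSpace ℝ (Fin 6) :=
  !₂[α * (T 0 0 + T 1 1 - T 2 2 - T 3 3) + β * (2 * (T 1 2 - T 0 3)),
    α * (2 * (T 1 2 + T 0 3)) + β * (T 0 0 - T 1 1 + T 2 2 - T 3 3),
    α * (2 * (T 1 3 - T 0 2)) + β * (2 * (T 2 3 + T 0 1)),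
    α * (T 0 0 + T 1 1 - T 2 2 - T 3 3) - β * (2 * (T 1 2 - T 0 3)),
    α * (2 * (T 1 2 + T 0 3)) - β * (T 0 0 - T 1 1 + T 2 2 - T 3 3),
    α * (2 * (T 1 3 - T 0 2)) - β * (2 * (T 2 3 + T 0 1))]

/-- For a rotation `R` with columns `x`, `y`, `x × y`, the matrix `v vᵀ`, where `v` is one of the
two unit quaternions representing `R`. Its entries are affine functions of those of `R`. -/
noncomputable def shepperdMatrix (x₁ x₂ x₃ y₁ y₂ y₃ : ℝ) : Matrix (Fin 4) (Fin 4) ℝ :=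
  (1 / 4 : ℝ) •
  !![1 + x₁ + y₂ + (x₁ * y₂ - x₂ * y₁), y₃ - (x₃ * y₁ - x₁ * y₃),
      (x₂ * y₃ - x₃ * y₂) - x₃, x₂ - y₁;
    y₃ - (x₃ * y₁ - x₁ * y₃), 1 + x₁ - y₂ - (x₁ * y₂ - x₂ * y₁),
      y₁ + x₂, (x₂ * y₃ - x₃ * y₂) + x₃;
    (x₂ * y₃ - x₃ * y₂) - x₃, y₁ + x₂,
      1 - x₁ + y₂ - (x₁ * y₂ - x₂ * y₁), (x₃ * y₁ - x₁ * y₃) + y₃;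
    x₂ - y₁, (x₂ * y₃ - x₃ * y₂) + x₃,
      (x₃ * y₁ - x₁ * y₃) + y₃, 1 - x₁ - y₂ + (x₁ * y₂ - x₂ * y₁)]

/-- The matrix `v vᵀ`, recovered from the pair `(α x + β y, α x - β y)`. -/
noncomputable def pairMatrix (α β : ℝ) (w : EuclideanSpace ℝ (Fin 6)) :
    Matrix (Fin 4) (Fin 4) ℝ :=
  shepperdMatrix ((w 0 + w 3) / (2 * α)) ((w 1 + w 4) / (2 * α)) ((w 2 + w 5) / (2 * α))
    ((w 0 - w 3) / (2 * β)) ((w 1 - w 4) / (2 * β)) ((w 2 - w 5) / (2 * β))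

theorem sum_sq_pos {v : Fin 4 → ℝ} (hv : v ≠ 0) :
    0 < v 0 ^ 2 + v 1 ^ 2 + v 2 ^ 2 + v 3 ^ 2 := by
  obtain ⟨i, hi⟩ := Function.ne_iff.1 hv
  have hi' : 0 < v i ^ 2 := by
    have : v i ≠ 0 := hi
    positivity
  have h := Finset.single_le_sum (fun k _ => sq_nonneg (v k)) (Finset.mem_univ i)
  rw [Fin.sum_univ_four] at h
  exact hi'.trans_le h

theorem projMatrix_smul {t : ℝ} (ht : t ≠ 0) (v : Fin 4 → ℝ) :
    projMatrix (t • v) = projMatrix v := by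
  ext i j
  simp only [projMatrix, Matrix.of_apply, Pi.smul_apply, smul_eq_mul]
  rw [← mul_div_mul_left (v i * v j) _ (pow_ne_zero 2 ht)]
  congr 1 <;> ring

theorem pairMatrix_rotationPair_projMatrix {α β : ℝ} (hα : α ≠ 0) (hβ : β ≠ 0)
    {v : Fin 4 → ℝ} (hv : v ≠ 0) :
    pairMatrix α β (rotationPair α β (projMatrix v)) = projMatrix v := by
  have hN := (sum_sq_pos hv).ne'
  ext i j
  fin_cases i <;> fin_cases j <;>
    simp [pairMatrix, rotationPair, projMatrix, shepperdMatrix] <;>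
    field_simp <;> ring

/-- The first two columns `x`, `y` of a rotation are orthonormal, so that `α x ± β y` have the
square norm `α² + β²` and the inner product `α² - β²`. -/
theorem rotationPair_projMatrix_mem {α β r c : ℝ} (hα : 2 * α ^ 2 = r ^ 2 + c)
    (hβ : 2 * β ^ 2 = r ^ 2 - c) {v : Fin 4 → ℝ} (hv : v ≠ 0) :
    rotationPair α β (projMatrix v) ∈ vectorPairs r c := by
  have hN := (sum_sq_pos hv).ne'
  have h1 : r ^ 2 = α ^ 2 + β ^ 2 := by linear_combination (-hα - hβ) / 2
  have h2 : c = α ^ 2 - β ^ 2 := by linear_combination (-hα + hβ) / 2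
  simp only [vectorPairs, mem_ofPred_eq, rotationPair, projMatrix, Matrix.cons_val,
    Matrix.of_apply]
  rw [h1, h2]
  refine ⟨?_, ?_, ?_⟩ <;> field_simp <;> ring

/-- This holds for every `w`, since the entries of the rotation are linear in those of `v vᵀ`; only
the rank of `pairMatrix α β w` depends on the orthogonality relations. -/
theorem rotationPair_pairMatrix {α β : ℝ} (hα : α ≠ 0) (hβ : β ≠ 0)
    (w : EuclideanSpace ℝ (Fin 6)) : rotationPair α β (pairMatrix α β w) = w := by
  ext i
  fin_cases i <;> simp [pairMatrix, rotationPair, shepperdMatrix] <;> field_simp <;> ring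

/-- For orthonormal `x` and `y`, the symmetric matrix `shepperdMatrix` has rank one. The identities
are linear combinations of the orthonormality relations for rows and columns of the rotation and of
the identities between its entries and its cofactors. -/
theorem shepperdMatrix_mul {x₁ x₂ x₃ y₁ y₂ y₃ : ℝ} (hx : x₁ ^ 2 + x₂ ^ 2 + x₃ ^ 2 = 1)
    (hy : y₁ ^ 2 + y₂ ^ 2 + y₃ ^ 2 = 1) (hxy : x₁ * y₁ + x₂ * y₂ + x₃ * y₃ = 0)
    (i j k : Fin 4) :
    shepperdMatrix x₁ x₂ x₃ y₁ y₂ y₃ j i * shepperdMatrix x₁ x₂ x₃ y₁ y₂ y₃ k i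
      = shepperdMatrix x₁ x₂ x₃ y₁ y₂ y₃ i i * shepperdMatrix x₁ x₂ x₃ y₁ y₂ y₃ j k := by
  obtain ⟨z₁, hz₁⟩ : ∃ z₁, z₁ = x₂ * y₃ - x₃ * y₂ := ⟨_, rfl⟩
  obtain ⟨z₂, hz₂⟩ : ∃ z₂, z₂ = x₃ * y₁ - x₁ * y₃ := ⟨_, rfl⟩
  obtain ⟨z₃, hz₃⟩ : ∃ z₃, z₃ = x₁ * y₂ - x₂ * y₁ := ⟨_, rfl⟩
  have ex₁ : x₁ = y₂ * z₃ - y₃ * z₂ := by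
    rw [hz₂, hz₃]; linear_combination y₁ * hxy - x₁ * hy
  have ex₂ : x₂ = y₃ * z₁ - y₁ * z₃ := by
    rw [hz₁, hz₃]; linear_combination y₂ * hxy - x₂ * hy
  have ex₃ : x₃ = y₁ * z₂ - y₂ * z₁ := by
    rw [hz₁, hz₂]; linear_combination y₃ * hxy - x₃ * hy
  have ey₁ : y₁ = z₂ * x₃ - z₃ * x₂ := by
    rw [hz₂, hz₃]; linear_combination x₁ * hxy - y₁ * hx
  have ey₂ : y₂ = z₃ * x₁ - z₁ * x₃ := by
    rw [hz₁, hz₃]; linear_combination x₂ * hxy - y₂ * hx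
  have ey₃ : y₃ = z₁ * x₂ - z₂ * x₁ := by
    rw [hz₁, hz₂]; linear_combination x₃ * hxy - y₃ * hx
  have hz : z₁ ^ 2 + z₂ ^ 2 + z₃ ^ 2 = 1 := by
    rw [hz₁, hz₂, hz₃]
    linear_combination (y₁ ^ 2 + y₂ ^ 2 + y₃ ^ 2) * hx + hy
      - (x₁ * y₁ + x₂ * y₂ + x₃ * y₃) * hxy
  have hxz : x₁ * z₁ + x₂ * z₂ + x₃ * z₃ = 0 := by rw [hz₁, hz₂, hz₃]; ring
  have hyz : y₁ * z₁ + y₂ * z₂ + y₃ * z₃ = 0 := by rw [hz₁, hz₂, hz₃]; ring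
  -- the rows of the rotation with columns `x`, `y`, `z` are orthonormal, too
  have r₁ : x₁ ^ 2 + y₁ ^ 2 + z₁ ^ 2 = 1 := by
    linear_combination x₁ * ex₁ + y₁ * ey₁ + z₁ * hz₁ + hx - x₁ * ex₁ - x₂ * ex₂ - x₃ * ex₃
  have r₂ : x₂ ^ 2 + y₂ ^ 2 + z₂ ^ 2 = 1 := by
    linear_combination x₂ * ex₂ + y₂ * ey₂ + z₂ * hz₂ + hx - x₁ * ex₁ - x₂ * ex₂ - x₃ * ex₃
  have r₃ : x₃ ^ 2 + y₃ ^ 2 + z₃ ^ 2 = 1 := by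
    linear_combination x₃ * ex₃ + y₃ * ey₃ + z₃ * hz₃ + hx - x₁ * ex₁ - x₂ * ex₂ - x₃ * ex₃
  have r₁₂ : x₁ * x₂ + y₁ * y₂ + z₁ * z₂ = 0 := by
    linear_combination x₁ * ex₂ + y₁ * ey₂ + z₁ * hz₂
  have r₁₃ : x₁ * x₃ + y₁ * y₃ + z₁ * z₃ = 0 := by
    linear_combination x₁ * ex₃ + y₁ * ey₃ + z₁ * hz₃
  have r₂₃ : x₂ * x₃ + y₂ * y₃ + z₂ * z₃ = 0 := by
    linear_combination x₂ * ex₃ + y₂ * ey₃ + z₂ * hz₃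
  simp only [shepperdMatrix, ← hz₁, ← hz₂, ← hz₃]
  fin_cases i <;> fin_cases j <;> fin_cases k <;>
    simp only [Matrix.smul_apply, Matrix.of_apply, Matrix.cons_val, smul_eq_mul,
      Fin.mk_one, Fin.zero_eta, Fin.reduceFinMk] <;>
    first | ring1 | linarith

theorem shepperdMatrix_trace (x₁ x₂ x₃ y₁ y₂ y₃ : ℝ) :
    shepperdMatrix x₁ x₂ x₃ y₁ y₂ y₃ 0 0 + shepperdMatrix x₁ x₂ x₃ y₁ y₂ y₃ 1 1
      + shepperdMatrix x₁ x₂ x₃ y₁ y₂ y₃ 2 2 + shepperdMatrix x₁ x₂ x₃ y₁ y₂ y₃ 3 3 = 1 := by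
  simp [shepperdMatrix]
  ring

/-- A symmetric matrix of rank one and trace one is the projection onto a line, namely onto the
line spanned by any of its columns that is nonzero. -/
theorem exists_pairMatrix_eq_projMatrix {α β r c : ℝ} (hα : 2 * α ^ 2 = r ^ 2 + c)
    (hβ : 2 * β ^ 2 = r ^ 2 - c) (hα0 : α ≠ 0) (hβ0 : β ≠ 0) {w : EuclideanSpace ℝ (Fin 6)}
    (hw : w ∈ vectorPairs r c) : ∃ v : Fin 4 → ℝ, v ≠ 0 ∧ pairMatrix α β w = projMatrix v := by
  obtain ⟨h1, h2, h3⟩ := hw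
  have hmul := fun i j k => shepperdMatrix_mul (x₁ := (w 0 + w 3) / (2 * α))
    (x₂ := (w 1 + w 4) / (2 * α)) (x₃ := (w 2 + w 5) / (2 * α)) (y₁ := (w 0 - w 3) / (2 * β))
    (y₂ := (w 1 - w 4) / (2 * β)) (y₃ := (w 2 - w 5) / (2 * β))
    (by field_simp; linear_combination h1 + h2 + 2 * h3 - 2 * hα)
    (by field_simp; linear_combination h1 + h2 - 2 * h3 - 2 * hβ)
    (by field_simp; linear_combination h1 - h2) i j k
  have htr : pairMatrix α β w 0 0 + pairMatrix α β w 1 1 + pairMatrix α β w 2 2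
    + pairMatrix α β w 3 3 = 1 := shepperdMatrix_trace ..
  change ∀ i j k, pairMatrix α β w j i * pairMatrix α β w k i
    = pairMatrix α β w i i * pairMatrix α β w j k at hmul
  generalize pairMatrix α β w = T at hmul htr
  obtain ⟨i, hi⟩ : ∃ i, T i i ≠ 0 := by
    by_contra! h
    simp [h] at htr
  refine ⟨fun j => T j i, fun h => hi (congrFun h i), ?_⟩
  have hsum : T 0 i ^ 2 + T 1 i ^ 2 + T 2 i ^ 2 + T 3 i ^ 2 = T i i := by
    linear_combination hmul i 0 0 + hmul i 1 1 + hmul i 2 2 + hmul i 3 3 + T i i * htr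
  ext j k
  simp only [projMatrix, Matrix.of_apply]
  rw [hsum, hmul, mul_div_cancel_left₀ _ hi]

/-! ### The embedding of the projective space -/

namespace RealProjectiveSpace

instance (n : ℕ) : CompactSpace (RealProjectiveSpace n) := by
  have hne : ∀ x : Metric.sphere (0 : Fin (n + 1) → ℝ) 1, x.1 ≠ 0 := fun x h => by
    have := mem_sphere_zero_iff_norm.1 x.2
    simp [h] at this
  refine Function.Surjective.compactSpace
    (f := fun x : Metric.sphere (0 : Fin (n + 1) → ℝ) 1 => mk ⟨x.1, hne x⟩) ?_ ?_
  · exact isQuotientMap_mk.continuous.comp (continuous_subtype_val.subtype_mk _)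
  · intro p
    obtain ⟨v, rfl⟩ := isQuotientMap_mk.surjective p
    have hv := norm_ne_zero_iff.2 v.2
    refine ⟨⟨‖v.1‖⁻¹ • v.1, ?_⟩, ?_⟩
    · rw [mem_sphere_zero_iff_norm, norm_smul, norm_inv, norm_norm, inv_mul_cancel₀ hv]
    · exact (Projectivization.mk_eq_mk_iff' ℝ _ _ _ v.2).2 ⟨‖v.1‖⁻¹, rfl⟩

/-- The orthogonal projection onto a line, as a map on the projective space. -/
noncomputable def projection : RealProjectiveSpace 3 → Matrix (Fin 4) (Fin 4) ℝ :=
  Projectivization.lift (K := ℝ) (fun v : {v : Fin 4 → ℝ // v ≠ 0} => projMatrix v.1)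
    (fun a b t h => by
      have ha := a.2
      rw [h] at ha
      have ht : t ≠ 0 := fun h0 => ha (by simp [h0])
      simp only [h, projMatrix_smul ht])

theorem projection_mk (v : {v : Fin 4 → ℝ // v ≠ 0}) : projection (mk v) = projMatrix v.1 := rfl

theorem projection_injective : Function.Injective projection := by
  intro p q h
  obtain ⟨v, rfl⟩ := isQuotientMap_mk.surjective p
  obtain ⟨w, rfl⟩ := isQuotientMap_mk.surjective q
  rw [projection_mk, projection_mk] at h
  obtain ⟨i, hi⟩ := Function.ne_iff.1 v.2
  have hi' : v.1 i ≠ 0 := hi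
  have hv := (sum_sq_pos v.2).ne'
  have hw := (sum_sq_pos w.2).ne'
  refine (Projectivization.mk_eq_mk_iff' ℝ _ _ v.2 w.2).2
    ⟨w.1 i * (v.1 0 ^ 2 + v.1 1 ^ 2 + v.1 2 ^ 2 + v.1 3 ^ 2) /
      (v.1 i * (w.1 0 ^ 2 + w.1 1 ^ 2 + w.1 2 ^ 2 + w.1 3 ^ 2)), ?_⟩
  ext j
  have hj := congrFun (congrFun h i) j
  simp only [projMatrix, Matrix.of_apply] at hj
  rw [div_eq_div_iff hv hw] at hj
  rw [Pi.smul_apply, smul_eq_mul, div_mul_eq_mul_div, div_eq_iff (by positivity)]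
  linear_combination -hj

/-- The map `[v] ↦ (α x + β y, α x - β y)`, where `x` and `y` are the first two columns of the
rotation given by the quaternion `v`. -/
noncomputable def toVectorPair (α β : ℝ) (p : RealProjectiveSpace 3) : EuclideanSpace ℝ (Fin 6) :=
  rotationPair α β (projection p)

theorem pairMatrix_toVectorPair {α β : ℝ} (hα : α ≠ 0) (hβ : β ≠ 0) (p : RealProjectiveSpace 3) :
    pairMatrix α β (toVectorPair α β p) = projection p := by
  obtain ⟨v, rfl⟩ := isQuotientMap_mk.surjective p
  exact pairMatrix_rotationPair_projMatrix hα hβ v.2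

theorem toVectorPair_injective {α β : ℝ} (hα : α ≠ 0) (hβ : β ≠ 0) :
    Function.Injective (toVectorPair α β) := by
  intro p q h
  apply projection_injective
  rw [← pairMatrix_toVectorPair hα hβ, h, pairMatrix_toVectorPair hα hβ]

theorem range_toVectorPair {α β r c : ℝ} (hα : 2 * α ^ 2 = r ^ 2 + c)
    (hβ : 2 * β ^ 2 = r ^ 2 - c) (hα0 : α ≠ 0) (hβ0 : β ≠ 0) :
    range (toVectorPair α β) = vectorPairs r c := by
  ext w
  constructor
  · rintro ⟨p, rfl⟩
    obtain ⟨v, rfl⟩ := isQuotientMap_mk.surjective p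
    exact rotationPair_projMatrix_mem hα hβ v.2
  · intro hw
    obtain ⟨v, hv, h⟩ := exists_pairMatrix_eq_projMatrix hα hβ hα0 hβ0 hw
    refine ⟨mk ⟨v, hv⟩, ?_⟩
    rw [toVectorPair, projection_mk, ← h, rotationPair_pairMatrix hα0 hβ0]

theorem contDiff_affineVec (i l : Fin 4) :
    ContDiff ℝ ∞ fun y : EuclideanSpace ℝ (Fin 3) => (affineVec i y).1 l := by
  refine Fin.succAboveCases i ?_ (fun j => ?_) l
  · simpa [affineVec] using contDiff_const
  · simp only [affineVec, Fin.insertNth_apply_succAbove]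
    fun_prop

theorem contDiff_toVectorPair_affineVec (α β : ℝ) (i : Fin 4) :
    ContDiff ℝ ∞ fun y : EuclideanSpace ℝ (Fin 3) => toVectorPair α β (mk (affineVec i y)) := by
  have hT : ∀ j k, ContDiff ℝ ∞ fun y : EuclideanSpace ℝ (Fin 3) =>
      projMatrix (affineVec i y).1 j k := fun j k =>
    ((contDiff_affineVec i j).mul (contDiff_affineVec i k)).div
      (((((contDiff_affineVec i 0).pow 2).add ((contDiff_affineVec i 1).pow 2)).add
        ((contDiff_affineVec i 2).pow 2)).add ((contDiff_affineVec i 3).pow 2))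
      fun y => (sum_sq_pos (affineVec i y).2).ne'
  rw [contDiff_euclidean]
  intro j
  fin_cases j <;> simp [toVectorPair, projection_mk, rotationPair] <;> fun_prop

theorem contMDiff_toVectorPair (α β : ℝ) : ContMDiff (𝓡 3) (𝓡 6) ∞ (toVectorPair α β) := by
  intro p
  obtain ⟨i, hi⟩ : ∃ i, chartAt (EuclideanSpace ℝ (Fin 3)) p = affineChart i := ⟨_, rfl⟩
  have h1 : ContMDiffAt (𝓡 3) (𝓡 3) ∞ (affineChart i) p := by
    rw [← hi]
    exact contMDiffOn_chart.contMDiffAt (chart_source_mem_nhds _ p)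
  have h2 := (contDiff_toVectorPair_affineVec α β i).contMDiff.contMDiffAt.comp p h1
  refine h2.congr_of_eventuallyEq ?_
  filter_upwards [chart_source_mem_nhds (EuclideanSpace ℝ (Fin 3)) p] with q hq
  rw [hi] at hq
  exact congrArg (toVectorPair α β) ((affineChart i).left_inv hq).symm

/-- The affine coordinates of a line are quotients of entries of the projection onto it. -/
theorem affineCoord_eq_projection {i : Fin 4} {p : RealProjectiveSpace 3} (hp : p ∈ chartDomain i) :
    affineCoord i p
      = WithLp.toLp 2 fun j => projection p (i.succAbove j) i / projection p i i := by
  obtain ⟨v, rfl⟩ := isQuotientMap_mk.surjective p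
  rw [mk_mem_chartDomain] at hp
  have hv := (sum_sq_pos v.2).ne'
  rw [affineCoord_mk, projection_mk]
  congr 1
  funext j
  simp only [projMatrix, Matrix.of_apply]
  field_simp

theorem projection_diag_ne_zero {i : Fin 4} {p : RealProjectiveSpace 3} (hp : p ∈ chartDomain i) :
    projection p i i ≠ 0 := by
  obtain ⟨v, rfl⟩ := isQuotientMap_mk.surjective p
  rw [mk_mem_chartDomain] at hp
  exact div_ne_zero (mul_ne_zero hp hp) (sum_sq_pos v.2).ne'

theorem differentiable_pairMatrix (α β : ℝ) (i j : Fin 4) :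
    Differentiable ℝ fun w => pairMatrix α β w i j := by
  fin_cases i <;> fin_cases j <;> simp [pairMatrix, shepperdMatrix] <;> fun_prop

/-- The differentials are injective, since the affine coordinates of `p` are differentiable
functions of the image of `p`. -/
theorem mfderiv_toVectorPair_injective {α β : ℝ} (hα : α ≠ 0) (hβ : β ≠ 0)
    (p : RealProjectiveSpace 3) :
    Function.Injective (mfderiv (𝓡 3) (𝓡 6) (toVectorPair α β) p) := by
  obtain ⟨i, hi⟩ : ∃ i, chartAt (EuclideanSpace ℝ (Fin 3)) p = affineChart i := ⟨_, rfl⟩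
  have hmem : p ∈ chartDomain i := by
    have := mem_chart_source (EuclideanSpace ℝ (Fin 3)) p
    rwa [hi] at this
  obtain ⟨ψ, hψ⟩ : ∃ ψ : EuclideanSpace ℝ (Fin 6) → EuclideanSpace ℝ (Fin 3), ∀ w, ψ w
      = WithLp.toLp 2 fun j => pairMatrix α β w (i.succAbove j) i / pairMatrix α β w i i :=
    ⟨_, fun _ => rfl⟩
  have hψd : DifferentiableAt ℝ ψ (toVectorPair α β p) := by
    rw [differentiableAt_euclidean]
    intro j
    have hfun : (fun w => ψ w j) = fun w =>
        pairMatrix α β w (i.succAbove j) i * (pairMatrix α β w i i)⁻¹ :=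
      funext fun w => by simp only [hψ, div_eq_mul_inv]
    rw [hfun]
    refine (differentiable_pairMatrix α β _ _).differentiableAt.fun_mul
      ((differentiable_pairMatrix α β _ _).differentiableAt.fun_inv ?_)
    rw [pairMatrix_toVectorPair hα hβ]
    exact projection_diag_ne_zero hmem
  have hcomp : ψ ∘ toVectorPair α β =ᶠ[𝓝 p] chartAt (EuclideanSpace ℝ (Fin 3)) p := by
    filter_upwards [chart_source_mem_nhds (EuclideanSpace ℝ (Fin 3)) p] with q hq
    rw [hi] at hq ⊢
    rw [Function.comp_apply, hψ, pairMatrix_toVectorPair hα hβ]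
    exact (affineCoord_eq_projection hq).symm
  have hchart : Function.Injective
      (mfderiv (𝓡 3) (𝓡 3) (chartAt (EuclideanSpace ℝ (Fin 3)) p) p) :=
    (mdifferentiable_chart (I := 𝓡 3) p).mfderiv_injective (mem_chart_source _ p)
  rw [← hcomp.mfderiv_eq, mfderiv_comp p hψd.mdifferentiableAt
    ((contMDiff_toVectorPair α β).mdifferentiableAt (by simp))] at hchart
  exact Function.Injective.of_comp hchart

end RealProjectiveSpace

/-- In the case of strict Cauchy-Schwarz inequality, the sum and the difference of the two vectors
have the lengths `2 α` and `2 β` with `2 α² = r² + c` and `2 β² = r² - c`, both positive. -/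
theorem isDiffeomorphicTo_realProjectiveSpace {V : Type*} [AddCommGroup V] [Module ℝ V]
    (L : V ≃ₗ[ℝ] EuclideanSpace ℝ (Fin 6)) {r c : ℝ} (hc : |c| < r ^ 2) :
    IsDiffeomorphicTo (L ⁻¹' vectorPairs r c) (n := 3) (RealProjectiveSpace 3) := by
  obtain ⟨h1, h2⟩ := abs_lt.1 hc
  have hα : 0 < (r ^ 2 + c) / 2 := by linarith
  have hβ : 0 < (r ^ 2 - c) / 2 := by linarith
  have hα0 := (Real.sqrt_pos.2 hα).ne'
  have hβ0 := (Real.sqrt_pos.2 hβ).ne'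
  refine isDiffeomorphicTo_preimage L
    (RealProjectiveSpace.toVectorPair √((r ^ 2 + c) / 2) √((r ^ 2 - c) / 2))
    (RealProjectiveSpace.contMDiff_toVectorPair _ _)
    (RealProjectiveSpace.mfderiv_toVectorPair_injective hα0 hβ0) ?_
    (RealProjectiveSpace.range_toVectorPair ?_ ?_ hα0 hβ0)
  · exact ((RealProjectiveSpace.contMDiff_toVectorPair _ _).continuous.isClosedEmbedding
      (RealProjectiveSpace.toVectorPair_injective hα0 hβ0)).isEmbedding
  · rw [Real.sq_sqrt hα.le]
    ring
  · rw [Real.sq_sqrt hβ.le]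
    ring

/-! ### The threshold -/

theorem IsDiffeomorphicTo.nonempty {V : Type*} [AddCommGroup V] [Module ℝ V] {X : Set V} {n : ℕ}
    {M : Type*} [TopologicalSpace M] [ChartedSpace (EuclideanSpace ℝ (Fin n)) M]
    [IsManifold (𝓡 n) ∞ M] [Nonempty M] (h : IsDiffeomorphicTo X (n := n) M) : X.Nonempty := by
  obtain ⟨-, -, f, -, -, -, rfl⟩ := h
  exact range_nonempty f

theorem abs_le_sq_of_mem_vectorPairs {r c : ℝ} {w : EuclideanSpace ℝ (Fin 6)}
    (hw : w ∈ vectorPairs r c) : |c| ≤ r ^ 2 := by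
  obtain ⟨h1, h2, h3⟩ := hw
  rw [abs_le]
  constructor
  · nlinarith [sq_nonneg (w 0 + w 3), sq_nonneg (w 1 + w 4), sq_nonneg (w 2 + w 5)]
  · nlinarith [sq_nonneg (w 0 - w 3), sq_nonneg (w 1 - w 4), sq_nonneg (w 2 - w 5)]

instance : Nonempty (RealProjectiveSpace 3) :=
  ⟨RealProjectiveSpace.mk ⟨fun _ => 1, fun h => one_ne_zero (congrFun h 0)⟩⟩

instance : Nonempty (Metric.sphere (0 : EuclideanSpace ℝ (Fin 3)) 1) :=
  (NormedSpace.sphere_nonempty.2 zero_le_one).to_subtype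

theorem orbitSlice_isDiffeomorphicTo_realProjectiveSpace {e u : Basis (Fin 4) ℝ Minkowski}
    (he : IsOrientedPseudoOrthonormal e) (hu : IsOrientedPseudoOrthonormal u) {φ : ℝ}
    (hφ : Real.cos φ ≠ 0) {r : ℝ} (hr : 0 < r) (h : |2 * Real.cos φ| < r ^ 2) :
    IsDiffeomorphicTo (orbitSlice e u φ r) (n := 3) (RealProjectiveSpace 3) := by
  rw [orbitSlice_eq_preimage he hu hφ hr]
  exact isDiffeomorphicTo_realProjectiveSpace (bivectorEquiv e) h

theorem orbitSlice_isDiffeomorphicTo_sphere {e u : Basis (Fin 4) ℝ Minkowski}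
    (he : IsOrientedPseudoOrthonormal e) (hu : IsOrientedPseudoOrthonormal u) {φ : ℝ}
    (hφ : Real.cos φ ≠ 0) {r : ℝ} (hr : 0 < r) (h : |2 * Real.cos φ| = r ^ 2) :
    IsDiffeomorphicTo (orbitSlice e u φ r) (n := 2)
      (Metric.sphere (0 : EuclideanSpace ℝ (Fin 3)) 1) := by
  rw [orbitSlice_eq_preimage he hu hφ hr]
  have hr2 : r ^ 2 ≠ 0 := by positivity
  refine isDiffeomorphicTo_sphere (bivectorEquiv e) hr (ε := 2 * Real.cos φ / r ^ 2) ?_ ?_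
  · rw [div_pow, ← sq_abs, h, div_self (pow_ne_zero 2 hr2)]
  · rw [div_mul_cancel₀ _ hr2]

theorem orbitSlice_nonempty_iff {e u : Basis (Fin 4) ℝ Minkowski}
    (he : IsOrientedPseudoOrthonormal e) (hu : IsOrientedPseudoOrthonormal u) {φ : ℝ}
    (hφ : Real.cos φ ≠ 0) {r : ℝ} (hr : 0 < r) :
    (orbitSlice e u φ r).Nonempty ↔ |2 * Real.cos φ| ≤ r ^ 2 := by
  constructor
  · rintro ⟨Ω, hΩ⟩
    rw [orbitSlice_eq_preimage he hu hφ hr] at hΩ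
    exact abs_le_sq_of_mem_vectorPairs hΩ
  · intro h
    rcases h.lt_or_eq with h | h
    · exact (orbitSlice_isDiffeomorphicTo_realProjectiveSpace he hu hφ hr h).nonempty
    · exact (orbitSlice_isDiffeomorphicTo_sphere he hu hφ hr h).nonempty

theorem sliceThreshold_eq {e u : Basis (Fin 4) ℝ Minkowski}
    (he : IsOrientedPseudoOrthonormal e) (hu : IsOrientedPseudoOrthonormal u) {φ : ℝ}
    (hφ : Real.cos φ ≠ 0) :
    sliceThreshold e u φ = √|2 * Real.cos φ| := by
  have hpos : 0 < √|2 * Real.cos φ| :=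
    Real.sqrt_pos.2 (abs_pos.2 (mul_ne_zero two_ne_zero hφ))
  have : {r | 0 < r ∧ (orbitSlice e u φ r).Nonempty} = Ici √|2 * Real.cos φ| := by
    ext r
    constructor
    · rintro ⟨hr, h⟩
      exact Real.sqrt_le_iff.2 ⟨hr.le, (orbitSlice_nonempty_iff he hu hφ hr).1 h⟩
    · intro h
      have hr := hpos.trans_le h
      exact ⟨hr, (orbitSlice_nonempty_iff he hu hφ hr).2 (Real.sqrt_le_iff.1 h).2⟩
  rw [sliceThreshold, this, csInf_Ici]

theorem cos_ne_zero_of_mem_Icc {φ : ℝ} (h : φ ∈ Icc 0 Real.pi) (hne : φ ≠ Real.pi / 2) :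
    Real.cos φ ≠ 0 := by
  intro h0
  refine hne (Real.injOn_cos h ⟨by positivity, by linarith [Real.pi_pos]⟩ ?_)
  rw [h0, Real.cos_pi_div_two]

/-- The half-angle computation common to both ranges of `φ`, with `a` and `b` the cosine and the
sine of `φ / 2` in one of the two orders. -/
theorem sqrt_two_mul_div_cosh_artanh {a b : ℝ} (ha : 0 < a) (hb : 0 ≤ b) (hab : b < a) :
    √2 * (a / Real.cosh (Real.artanh (b / a))) = √(2 * (a ^ 2 - b ^ 2)) := by
  have h1 : b / a < 1 := (div_lt_one ha).2 hab
  have h0 : 0 ≤ b / a := by positivity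
  rw [Real.cosh_artanh ⟨by linarith, h1⟩, one_div, div_inv_eq_mul, Real.sqrt_mul (by norm_num)]
  congr 1
  rw [← Real.sqrt_sq ha.le, ← Real.sqrt_mul (sq_nonneg a), Real.sqrt_sq ha.le]
  congr 1
  field_simp

theorem sqrt_two_mul_cos_div_cosh {φ : ℝ} (h : φ ∈ Ico 0 (Real.pi / 2)) :
    √2 * (Real.cos (φ / 2) / Real.cosh (tParam φ)) = √|2 * Real.cos φ| := by
  have h0 : 0 < Real.cos φ := Real.cos_pos_of_mem_Ioo ⟨by linarith [h.1, h.2], h.2⟩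
  have hc : 0 < Real.cos (φ / 2) :=
    Real.cos_pos_of_mem_Ioo ⟨by linarith [h.1, Real.pi_pos], by linarith [h.1, h.2]⟩
  have hs : 0 ≤ Real.sin (φ / 2) :=
    Real.sin_nonneg_of_nonneg_of_le_pi (by linarith [h.1]) (by linarith [h.1, h.2])
  have hcos : Real.cos φ = Real.cos (φ / 2) ^ 2 - Real.sin (φ / 2) ^ 2 := by
    rw [← Real.cos_two_mul', mul_div_cancel₀ _ two_ne_zero]
  rw [tParam, if_pos h.2, Real.tan_eq_sin_div_cos, abs_of_pos (by positivity),
    sqrt_two_mul_div_cosh_artanh hc hs (by nlinarith), hcos]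

theorem sqrt_two_mul_sin_div_cosh {φ : ℝ} (h : φ ∈ Ioc (Real.pi / 2) Real.pi) :
    √2 * (Real.sin (φ / 2) / Real.cosh (tParam φ)) = √|2 * Real.cos φ| := by
  have h0 : Real.cos φ < 0 :=
    Real.cos_neg_of_pi_div_two_lt_of_lt h.1 (by linarith [h.2, Real.pi_pos])
  have hs : 0 < Real.sin (φ / 2) :=
    Real.sin_pos_of_pos_of_lt_pi (by linarith [h.1, Real.pi_pos]) (by linarith [h.2, Real.pi_pos])
  have hc : 0 ≤ Real.cos (φ / 2) :=
    Real.cos_nonneg_of_mem_Icc ⟨by linarith [h.1, Real.pi_pos], by linarith [h.2]⟩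
  have hcos : Real.cos φ = Real.cos (φ / 2) ^ 2 - Real.sin (φ / 2) ^ 2 := by
    rw [← Real.cos_two_mul', mul_div_cancel₀ _ two_ne_zero]
  rw [tParam, if_neg h.1.le.not_gt, Real.cot_eq_cos_div_sin, abs_of_neg (by linarith),
    sqrt_two_mul_div_cosh_artanh hs hc (by nlinarith), hcos]
  congr 1
  ring

theorem mainTheorem3 (e u : Module.Basis (Fin 4) ℝ Minkowski)
    (he : IsOrientedPseudoOrthonormal e) (hu : IsOrientedPseudoOrthonormal u) :
    (∀ φ ∈ Set.Icc 0 Real.pi, φ ≠ Real.pi / 2 → 0 < sliceThreshold e u φ) ∧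
    (∀ φ ∈ Set.Ico 0 (Real.pi / 2),
      sliceThreshold e u φ = √2 * (Real.cos (φ / 2) / Real.cosh (tParam φ))) ∧
    (∀ φ ∈ Set.Ioc (Real.pi / 2) Real.pi,
      sliceThreshold e u φ = √2 * (Real.sin (φ / 2) / Real.cosh (tParam φ))) ∧
    (∀ φ ∈ Set.Icc 0 Real.pi, φ ≠ Real.pi / 2 →
      sliceThreshold e u (Real.pi - φ) = sliceThreshold e u φ) ∧
    Filter.Tendsto (sliceThreshold e u) (𝓝[≠] (Real.pi / 2)) (𝓝 0) ∧
    StrictAntiOn (sliceThreshold e u) (Set.Ico 0 (Real.pi / 2)) ∧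
    (∀ φ ∈ Set.Icc 0 Real.pi, φ ≠ Real.pi / 2 →
      (∀ r : ℝ, sliceThreshold e u φ < r →
        (orbitSlice e u φ r).Nonempty ∧
        IsDiffeomorphicTo (orbitSlice e u φ r) (n := 3) (RealProjectiveSpace 3)) ∧
      (orbitSlice e u φ (sliceThreshold e u φ)).Nonempty ∧
      IsDiffeomorphicTo (orbitSlice e u φ (sliceThreshold e u φ)) (n := 2)
        (Metric.sphere (0 : EuclideanSpace ℝ (Fin 3)) 1)) := by
  have hpi := Real.pi_pos
  have hthr : ∀ φ ∈ Icc 0 Real.pi, φ ≠ Real.pi / 2 →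
      sliceThreshold e u φ = √|2 * Real.cos φ| :=
    fun φ h hne => sliceThreshold_eq he hu (cos_ne_zero_of_mem_Icc h hne)
  have hpos : ∀ φ ∈ Icc 0 Real.pi, φ ≠ Real.pi / 2 → 0 < sliceThreshold e u φ := by
    intro φ h hne
    rw [hthr φ h hne]
    exact Real.sqrt_pos.2 (abs_pos.2 (mul_ne_zero two_ne_zero (cos_ne_zero_of_mem_Icc h hne)))
  refine ⟨hpos, fun φ h => ?_, fun φ h => ?_, fun φ h hne => ?_, ?_, fun φ h ψ h' hlt => ?_,
    fun φ h hne => ?_⟩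
  · rw [sqrt_two_mul_cos_div_cosh h, hthr φ ⟨h.1, by linarith [h.2]⟩ h.2.ne]
  · rw [sqrt_two_mul_sin_div_cosh h, hthr φ ⟨by linarith [h.1], h.2⟩ h.1.ne']
  · rw [hthr φ h hne, hthr (Real.pi - φ) ⟨by linarith [h.2], by linarith [h.1]⟩
      fun h' => hne (by linarith), Real.cos_pi_sub, mul_neg, abs_neg]
  · have hcont : Tendsto (fun φ => √|2 * Real.cos φ|) (𝓝[≠] (Real.pi / 2)) (𝓝 0) := by
      have hc : Continuous fun φ => √|2 * Real.cos φ| := by fun_prop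
      have := hc.tendsto (Real.pi / 2)
      simp only [Real.cos_pi_div_two, mul_zero, abs_zero, Real.sqrt_zero] at this
      exact this.mono_left nhdsWithin_le_nhds
    refine hcont.congr' ?_
    have hnhds : Icc 0 Real.pi ∈ 𝓝 (Real.pi / 2) := Icc_mem_nhds (by linarith) (by linarith)
    filter_upwards [self_mem_nhdsWithin, mem_nhdsWithin_of_mem_nhds hnhds] with φ hne h
    exact (hthr φ h hne).symm
  · have hcos : ∀ x ∈ Ico 0 (Real.pi / 2), 0 < Real.cos x := fun x hx =>
      Real.cos_pos_of_mem_Ioo ⟨by linarith [hx.1], hx.2⟩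
    have h1 := hcos φ h
    have h2 := hcos ψ h'
    rw [hthr φ ⟨h.1, by linarith [h.2]⟩ h.2.ne, hthr ψ ⟨h'.1, by linarith [h'.2]⟩ h'.2.ne,
      abs_of_pos (by positivity), abs_of_pos (by positivity)]
    refine Real.sqrt_lt_sqrt (by positivity) ?_
    linarith [Real.cos_lt_cos_of_nonneg_of_le_pi h.1 (by linarith [h'.2]) hlt]
  · have hc := cos_ne_zero_of_mem_Icc h hne
    have h0 := hpos φ h hne
    have hsq : |2 * Real.cos φ| = sliceThreshold e u φ ^ 2 := by
      rw [hthr φ h hne, Real.sq_sqrt (abs_nonneg _)]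
    have hS := orbitSlice_isDiffeomorphicTo_sphere he hu hc h0 hsq
    refine ⟨fun r hr => ?_, hS.nonempty, hS⟩
    have hP := orbitSlice_isDiffeomorphicTo_realProjectiveSpace he hu hc (h0.trans hr)
      (by rw [hsq]; gcongr)
    exact ⟨hP.nonempty, hP⟩
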